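/- Let $(\Omega,\mathcal F,\mathbb P)$ be an atomless probability space, let $S=(S_1,\dots,S_s)$ be a partition of $\Omega$ into finitely many events of positive probability, and put $\mathbb P_j=\mathbb P(\cdot\mid S_j)$ and $\mathbb P^S=(\mathbb P_1,\dots,\mathbb P_s)$. Let $\mathcal L^\infty$ be the set of bounded random variables and $\mathcal L_1$ the set of random variables with values in $[0,1]$. Let $g:[0,1]^s\to\mathbb R$ be componentwise increasing (in the non-strict sense) with $g(\mathbf 0)=0$ and $g(\mathbf 1)=1$, and let $\rho:\mathcal L^\infty\to\mathbb R$ be the $S$-distortion risk measure with $S$-distortion function $g$, that is, the Choquet integral $$\rho(X)=\int_0^\infty g\bigl(\mathbb P^S(X>x)\bigr)\,\mathrm dx+\int_{-\infty}^0\Bigl(g\bigl(\mathbb P^S(X>x)\bigr)-1\Bigr)\,\mathrm dx,\qquad X\in\mathcal L^\infty .$$ The following conditions (i)–(iii) are equivalent. (i) $\rho$ is coherent, i.e. monotone, translation invariant ($\rho(X+a)=\rho(X)+a$ for $a\in\mathbb R$), convex, and positively homogeneous ($\rho(\lambda X)=\lambda\rho(X)$ for $\lambda>0$). (ii) $\rho$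 is quasi-convex [QC]: $\rho(\lambda X+(1-\lambda)Y)\le\max\{\rho(X),\rho(Y)\}$ for all $X,Y\in\mathcal L^\infty$ and $\lambda\in[0,1]$. (iii) $g$ is componentwise concave and submodular on $[0,1]^s$, where submodular means $g(\mathbf x\wedge\mathbf y)+g(\mathbf x\vee\mathbf y)\le g(\mathbf x)+g(\mathbf y)$ for all $\mathbf x,\mathbf y\in[0,1]^s$ (with componentwise minimum and maximum). Conditions (i)–(iii) imply each of the following. (iv) [$S$-RA] If $X,Y\in\mathcal L^\infty$ and $\mathbb E^{\mathbb P_j}[\phi(X)]\le\mathbb E^{\mathbb P_j}[\phi(Y)]$ for every increasing convex function $\phi:\mathbb R\to\mathbb R$ and every $j$, then $\rho(X)\le\rho(Y)$. (v) [$S$-PE] For every sequence $(L_\ell)_{\ell\ge1}$ in $\mathcal L_1$ that is conditionally iid under each $\mathbb P_j$ (that is, for each $j$ it is, under $\mathbb P_j$, conditionally iid given some random vector $Z_j$), all integers $1\le\ell\le\ell'$ and all $K\in[0,1)$, writing $L^{(\ell)}=(L_1+\dots+L_\ell)/\ell$, $$\rho\left(\frac{(L^{(\ell)}-K)_+}{1-K}\right)\ge\rho\left(\frac{(L^{(\ell')}-K)_+}{1-K}\right).$$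 (vi) [$S$-PE*] The inequality in (v) holds for $K=0$ (for all such sequences and all such $\ell,\ell'$). Say that $\rho$ has the Lebesgue property [LC] if $\rho(X_\ell)\to\rho(X)$ whenever $(X_\ell)$ is a uniformly bounded sequence in $\mathcal L^\infty$ that converges almost surely to $X\in\mathcal L^\infty$. Then $\rho$ has [LC] if and only if $g$ is continuous on $[0,1]^s$, and if $\rho$ has [LC], all six conditions (i)–(vi) are equivalent. -/

import Mathlib

open MeasureTheory ProbabilityTheory Set Filter Topology

namespace ScenarioRisk

noncomputable section

/-- A measure is atomless if every measurable set of positive measure has a measurable subset of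
strictly smaller positive measure. -/
def Atomless {Ω : Type*} [MeasurableSpace Ω] (P : Measure Ω) : Prop :=
  ∀ A : Set Ω, MeasurableSet A → 0 < P A →
    ∃ B : Set Ω, B ⊆ A ∧ MeasurableSet B ∧ 0 < P B ∧ P B < P A

/-- `S₁, …, Sₛ` are disjoint events of positive probability that cover `Ω`. -/
structure IsScenarios {Ω : Type*} [MeasurableSpace Ω] (P : Measure Ω) {s : ℕ}
    (S : Fin s → Set Ω) : Prop where
  measurableSet : ∀ j, MeasurableSet (S j)
  disjoint : ∀ i j, i ≠ j → Disjoint (S i) (S j)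
  pos : ∀ j, 0 < P (S j)
  cover : ⋃ j, S j = univ

/-- The set `𝓛^∞` of bounded random variables. -/
def Linfty (Ω : Type*) [MeasurableSpace Ω] : Set (Ω → ℝ) :=
  {X | Measurable X ∧ ∃ C : ℝ, ∀ ω, |X ω| ≤ C}

/-- The set `𝓛₁` of random variables with values in `[0,1]`. -/
def LOne (Ω : Type*) [MeasurableSpace Ω] : Set (Ω → ℝ) :=
  {X | Measurable X ∧ ∀ ω, X ω ∈ Icc (0 : ℝ) 1}

/-- The vector `P^S(A) = (P(A | S₁), …, P(A | Sₛ))`. -/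
def scenarioProb {Ω : Type*} [MeasurableSpace Ω] (P : Measure Ω) {s : ℕ} (S : Fin s → Set Ω)
    (A : Set Ω) : Fin s → ℝ :=
  fun j => (P[|S j]).real A

/-- The Choquet integral of `X` with respect to the set function `ν`. -/
def choquetIntegral {Ω : Type*} (ν : Set Ω → ℝ) (X : Ω → ℝ) : ℝ :=
  (∫ x in Ioi (0 : ℝ), ν {ω | x < X ω}) + ∫ x in Iio (0 : ℝ), (ν {ω | x < X ω} - 1)

/-- An `S`-distortion function: a componentwise increasing `g : [0,1]^s → ℝ` with `g(𝟎) = 0` and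
`g(𝟏) = 1`. Only the values of `g` on the cube `[0,1]^s` are relevant. -/
structure IsDistortionFunction {s : ℕ} (g : (Fin s → ℝ) → ℝ) : Prop where
  mono : MonotoneOn g (Icc 0 1)
  map_zero : g 0 = 0
  map_one : g 1 = 1

/-- `ρ` is the `S`-distortion risk measure on `𝓛^∞` with `S`-distortion function `g`. Only the
values of `ρ` on `𝓛^∞` are relevant. -/
structure IsDistortionRiskMeasure {Ω : Type*} [MeasurableSpace Ω] (P : Measure Ω) {s : ℕ}
    (S : Fin s → Set Ω) (g : (Fin s → ℝ) → ℝ) (ρ : (Ω → ℝ) → ℝ) : Prop where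
  distortion : IsDistortionFunction g
  eq_choquet : ∀ X ∈ Linfty Ω, ρ X = choquetIntegral (fun A => g (scenarioProb P S A)) X

/-- Coherent risk measures on `𝓛^∞`: monotone, translation invariant, convex and positively
homogeneous. -/
structure IsCoherent {Ω : Type*} [MeasurableSpace Ω] (P : Measure Ω) (ρ : (Ω → ℝ) → ℝ) :
    Prop where
  mono : ∀ X ∈ Linfty Ω, ∀ Y ∈ Linfty Ω, (∀ᵐ ω ∂P, X ω ≤ Y ω) → ρ X ≤ ρ Y
  translation : ∀ X ∈ Linfty Ω, ∀ a : ℝ, ρ (fun ω => X ω + a) = ρ X + a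
  convex : ∀ X ∈ Linfty Ω, ∀ Y ∈ Linfty Ω, ∀ t ∈ Icc (0 : ℝ) 1,
    ρ (fun ω => t * X ω + (1 - t) * Y ω) ≤ t * ρ X + (1 - t) * ρ Y
  homogeneous : ∀ X ∈ Linfty Ω, ∀ t : ℝ, 0 < t → ρ (fun ω => t * X ω) = t * ρ X

/-- Quasi-convexity [QC]. -/
def QuasiConvex {Ω : Type*} [MeasurableSpace Ω] (ρ : (Ω → ℝ) → ℝ) : Prop :=
  ∀ X ∈ Linfty Ω, ∀ Y ∈ Linfty Ω, ∀ t ∈ Icc (0 : ℝ) 1,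
    ρ (fun ω => t * X ω + (1 - t) * Y ω) ≤ max (ρ X) (ρ Y)

/-- `g` is concave in each coordinate on `[0,1]^s`, the other coordinates being fixed. -/
def ComponentwiseConcave {s : ℕ} (g : (Fin s → ℝ) → ℝ) : Prop :=
  ∀ x ∈ Icc (0 : Fin s → ℝ) 1, ∀ i : Fin s,
    ConcaveOn ℝ (Icc (0 : ℝ) 1) (fun t => g (Function.update x i t))

/-- `g` is submodular on `[0,1]^s`. -/
def Submodular {s : ℕ} (g : (Fin s → ℝ) → ℝ) : Prop :=
  ∀ x ∈ Icc (0 : Fin s → ℝ) 1, ∀ y ∈ Icc (0 : Fin s → ℝ) 1, g (x ⊓ y) + g (x ⊔ y) ≤ g x + g y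

/-- The `S`-increasing convex order `X ≤_{S-icx} Y`. -/
def SIcxLE {Ω : Type*} [MeasurableSpace Ω] (P : Measure Ω) {s : ℕ} (S : Fin s → Set Ω)
    (X Y : Ω → ℝ) : Prop :=
  ∀ φ : ℝ → ℝ, Monotone φ → ConvexOn ℝ univ φ →
    ∀ j, ∫ ω, φ (X ω) ∂(P[|S j]) ≤ ∫ ω, φ (Y ω) ∂(P[|S j])

/-- `S`-risk aversion consistency [S-RA]. -/
def SRiskAverse {Ω : Type*} [MeasurableSpace Ω] (P : Measure Ω) {s : ℕ} (S : Fin s → Set Ω)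
    (ρ : (Ω → ℝ) → ℝ) : Prop :=
  ∀ X ∈ Linfty Ω, ∀ Y ∈ Linfty Ω, SIcxLE P S X Y → ρ X ≤ ρ Y

/-- Under `Q`, the sequence `L` is iid conditionally on the σ-algebra `m`: conditionally
independent and conditionally identically distributed. -/
structure CondIIDGiven {Ω : Type*} (m : MeasurableSpace Ω) [MeasurableSpace Ω] (Q : Measure Ω)
    (L : ℕ → Ω → ℝ) : Prop where
  indep : ∀ (I : Finset ℕ) (B : ℕ → Set ℝ), (∀ i, MeasurableSet (B i)) →
    Q⟦⋂ i ∈ I, L i ⁻¹' B i | m⟧ =ᵐ[Q] ∏ i ∈ I, Q⟦L i ⁻¹' B i | m⟧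
  identDistrib : ∀ (i k : ℕ) (B : Set ℝ), MeasurableSet B →
    Q⟦L i ⁻¹' B | m⟧ =ᵐ[Q] Q⟦L k ⁻¹' B | m⟧

/-- Under `Q`, the sequence `L` is conditionally iid: iid given some random vector `Z`. -/
def CondIID {Ω : Type*} [MeasurableSpace Ω] (Q : Measure Ω) (L : ℕ → Ω → ℝ) : Prop :=
  ∃ (d : ℕ) (Z : Ω → Fin d → ℝ), Measurable Z ∧
    CondIIDGiven (MeasurableSpace.comap Z inferInstance) Q L

/-- The standardized pooled loss `(L₁ + ⋯ + L_ℓ) / ℓ`; the sequence is indexed from `0`. -/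
def pool {Ω : Type*} (L : ℕ → Ω → ℝ) (l : ℕ) : Ω → ℝ :=
  fun ω => (∑ i ∈ Finset.range l, L i ω) / l

/-- The standardized loss `(X - K)₊ / (1 - K)` of the senior tranche with attachment point `K`. -/
def seniorTranche {Ω : Type*} (X : Ω → ℝ) (K : ℝ) : Ω → ℝ :=
  fun ω => max (X ω - K) 0 / (1 - K)

/-- The `S`-pooling effect at the attachment point `K`. -/
def SPoolingAt {Ω : Type*} [MeasurableSpace Ω] (P : Measure Ω) {s : ℕ} (S : Fin s → Set Ω)
    (ρ : (Ω → ℝ) → ℝ) (K : ℝ) : Prop :=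
  ∀ L : ℕ → Ω → ℝ, (∀ i, L i ∈ LOne Ω) → (∀ j, CondIID (P[|S j]) L) →
    ∀ l l' : ℕ, 1 ≤ l → l ≤ l' →
      ρ (seniorTranche (pool L l') K) ≤ ρ (seniorTranche (pool L l) K)

/-- `S`-pooling effect consistency [S-PE]. -/
def SPooling {Ω : Type*} [MeasurableSpace Ω] (P : Measure Ω) {s : ℕ} (S : Fin s → Set Ω)
    (ρ : (Ω → ℝ) → ℝ) : Prop :=
  ∀ K ∈ Ico (0 : ℝ) 1, SPoolingAt P S ρ K

/-- The weaker property [S-PE*]: the attachment point `K = 0` only. -/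
def SPoolingStar {Ω : Type*} [MeasurableSpace Ω] (P : Measure Ω) {s : ℕ} (S : Fin s → Set Ω)
    (ρ : (Ω → ℝ) → ℝ) : Prop :=
  SPoolingAt P S ρ 0

/-- Lebesgue continuity [LC]: continuity along bounded almost surely convergent sequences. -/
def LebesgueContinuous {Ω : Type*} [MeasurableSpace Ω] (P : Measure Ω) (ρ : (Ω → ℝ) → ℝ) : Prop :=
  ∀ (X : ℕ → Ω → ℝ) (Y : Ω → ℝ), (∀ l, Measurable (X l)) → (∃ C : ℝ, ∀ l ω, |X l ω| ≤ C) →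
    Y ∈ Linfty Ω → (∀ᵐ ω ∂P, Tendsto (fun l => X l ω) atTop (𝓝 (Y ω))) →
      Tendsto (fun l => ρ (X l)) atTop (𝓝 (ρ Y))

end

end ScenarioRisk

/-! Everything turns on one four-point inequality, g(u+h+k) + g(u) ≤ g(u+h) + g(u+k) on the cube
(`DecreasingIncrements`). For monotone g it is equivalent to (iii): submodularity handles increments
in different coordinates and concavity handles increments in the same coordinate
(`decreasingIncrements_iff`).

The inequality makes A ↦ g(P^S(A)) a submodular set function, and the Choquet integral of a
submodular capacity is subadditive; with homogeneity this gives convexity, hence (i), hence (ii).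
Conversely, after a shift that makes both risks vanish, quasi-convexity becomes subadditivity.
Testing it on two indicators returns the four-point inequality, since ρ(1_A + 1_B) = g(P^S(A ∪ B)) +
g(P^S(A ∩ B)) and an atomless space contains events with any prescribed vector of conditional
probabilities (`IsScenarios.exists_events`).

For (iv), cut losses into unit layers. The vectors of expected layer losses decrease along the
layers, their tail sums are stop-loss premia, and g of them is squeezed between g at consecutive
survival vectors. A majorization inequality for g (`DecreasingIncrements.sum_le_sum`) then compares
the two risks up to an additive constant, which scaling removes. Pooling follows from (iv) because
conditionally iid sequences are exchangeable: the average of l + 1 losses is the mean of its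
leave-one-out averages, each distributed like the average of l losses, so Jensen applies.

To return from (vi) under [LC], take losses that are certain on one event, fair coins on a second
and 1/2 on a third. Pooling infinitely many replaces each coin by 1/2, and comparing the limit with
a single loss gives the four-point inequality for well separated increments; subdivision and
continuity of g remove the separation (`decreasingIncrements_of_sPoolingStar`). -/

namespace ScenarioRisk

/-! ### Decreasing increments, componentwise concavity and submodularity -/

/-- The increments `g (u + h) - g u` decrease in `u` on the cube `[0,1]^s`. -/
def DecreasingIncrements {s : ℕ} (g : (Fin s → ℝ) → ℝ) : Prop :=
  ∀ u h k : Fin s → ℝ, 0 ≤ u → 0 ≤ h → 0 ≤ k → u + h + k ≤ 1 →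
    g (u + h + k) + g u ≤ g (u + h) + g (u + k)

/-- The inner points a + h and a + k are convex combinations of the endpoints with interchanged
weights, so the two concavity inequalities add up to the claim. -/
lemma _root_.ConcaveOn.add_le_add_of_nonneg {φ : ℝ → ℝ} {D : Set ℝ} (hφ : ConcaveOn ℝ D φ)
    {a h k : ℝ} (h0 : 0 ≤ h) (k0 : 0 ≤ k) (ha : a ∈ D) (hb : a + h + k ∈ D) :
    φ (a + h + k) + φ a ≤ φ (a + h) + φ (a + k) := by
  rcases (add_nonneg h0 k0).eq_or_lt with h1 | h1
  · obtain rfl : h = 0 := by linarith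
    obtain rfl : k = 0 := by linarith
    simp
  have e : k / (h + k) + h / (h + k) = 1 := by field_simp; ring
  have e' : h / (h + k) + k / (h + k) = 1 := by field_simp
  have h2 := hφ.2 ha hb (div_nonneg k0 h1.le) (div_nonneg h0 h1.le) e
  have h3 := hφ.2 ha hb (div_nonneg h0 h1.le) (div_nonneg k0 h1.le) e'
  simp only [smul_eq_mul] at h2 h3
  rw [show k / (h + k) * a + h / (h + k) * (a + h + k) = a + h by field_simp; ring] at h2
  rw [show h / (h + k) * a + k / (h + k) * (a + h + k) = a + k by field_simp; ring] at h3
  have : k / (h + k) = 1 - h / (h + k) := by linarith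
  rw [this] at h2 h3
  linarith

/-- A concave finite sequence lies above its chord. -/
lemma chord_le_of_decreasing_increments {f : ℕ → ℝ} {n k : ℕ} (hk : k ≤ n)
    (hf : ∀ i j, j ≤ i → i + 1 ≤ n → f (i + 1) - f i ≤ f (j + 1) - f j) :
    (n - k : ℝ) * f 0 + k * f n ≤ n * f k := by
  rcases hk.eq_or_lt with rfl | hk'
  · simp
  have h1 : ∑ i ∈ Finset.Ico k n, (f (i + 1) - f i) ≤ (n - k : ℝ) * (f (k + 1) - f k) := by
    calc _ ≤ ∑ i ∈ Finset.Ico k n, (f (k + 1) - f k) :=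
          Finset.sum_le_sum fun i hi => by
            rw [Finset.mem_Ico] at hi; exact hf i k hi.1 (by omega)
      _ = _ := by rw [Finset.sum_const, Nat.card_Ico, nsmul_eq_mul, Nat.cast_sub hk]
  have h2 : (k : ℝ) * (f (k + 1) - f k) ≤ ∑ i ∈ Finset.range k, (f (i + 1) - f i) := by
    calc _ = ∑ i ∈ Finset.range k, (f (k + 1) - f k) := by
          rw [Finset.sum_const, Finset.card_range, nsmul_eq_mul]
      _ ≤ _ := Finset.sum_le_sum fun i hi => by
            rw [Finset.mem_range] at hi; exact hf k i hi.le (by omega)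
  rw [Finset.sum_Ico_eq_sub _ hk] at h1
  rw [Finset.sum_range_sub] at h1 h2
  rw [Finset.sum_range_sub] at h1
  have hkn : (0 : ℝ) ≤ n - k := by
    have : (k : ℝ) ≤ n := by exact_mod_cast hk
    linarith
  have h3 := mul_le_mul_of_nonneg_left h1 (Nat.cast_nonneg (α := ℝ) k)
  have h4 := mul_le_mul_of_nonneg_left h2 hkn
  nlinarith

/-- Decreasing increments give concavity along equally spaced grids only. Monotonicity takes the
place of continuity in passing to an arbitrary intermediate point. -/
lemma _root_.MonotoneOn.concaveOn_of_decreasing_increments {φ : ℝ → ℝ}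
    (hm : MonotoneOn φ (Icc 0 1))
    (hd : ∀ a h k, 0 ≤ a → 0 ≤ h → 0 ≤ k → a + h + k ≤ 1 →
      φ (a + h + k) + φ a ≤ φ (a + h) + φ (a + k)) :
    ConcaveOn ℝ (Icc 0 1) φ := by
  refine LinearOrder.concaveOn_of_lt (convex_Icc 0 1) ?_
  intro a ha b hb hab p q hp hq hpq
  simp only [smul_eq_mul]
  obtain rfl : p = 1 - q := by linarith
  by_contra! hlt
  -- On a grid of mesh (b - a) / n, rounding the weight q down to k / n lowers the chord by at most
  -- (φ b - φ a) / n. This n makes that loss smaller than the assumed defect of concavity.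
  obtain ⟨n, hn⟩ := exists_nat_gt ((φ b - φ a) / ((1 - q) * φ a + q * φ b
    - φ ((1 - q) * a + q * b)))
  rw [div_lt_iff₀ (by linarith)] at hn
  have hφ := hm ha hb hab.le
  have hn0 : (0 : ℝ) < n := by
    by_contra! h0
    have h0' : (n : ℝ) = 0 := le_antisymm h0 (Nat.cast_nonneg n)
    rw [h0'] at hn
    linarith
  set k := ⌊q * n⌋₊ with hk
  have hk1 : (k : ℝ) ≤ q * n := Nat.floor_le (by positivity)
  have hk2 : q * n < k + 1 := Nat.lt_floor_add_one _
  have hkn : k ≤ n := by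
    have : (k : ℝ) ≤ n := hk1.trans (by nlinarith)
    exact_mod_cast this
  set δ := (b - a) / n with hδ
  have hδ0 : 0 ≤ δ := div_nonneg (by linarith) hn0.le
  have hδn : n * δ = b - a := by rw [hδ]; field_simp
  have hc := chord_le_of_decreasing_increments (f := fun i : ℕ => φ (a + i * δ)) hkn (by
    intro i j hji hin
    have hin' : (i : ℝ) + 1 ≤ n := by exact_mod_cast hin
    have hji' : (j : ℝ) ≤ i := by exact_mod_cast hji
    have := hd (a + j * δ) δ ((i - j) * δ) (add_nonneg ha.1 (by positivity)) hδ0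
      (mul_nonneg (by linarith) hδ0) (by nlinarith [hb.2])
    rw [show a + j * δ + δ + (i - j) * δ = a + (i + 1) * δ by ring,
      show a + j * δ + δ = a + (j + 1) * δ by ring,
      show a + j * δ + (i - j) * δ = a + i * δ by ring] at this
    push_cast
    linarith)
  simp only [Nat.cast_zero, zero_mul, add_zero, hδn, add_sub_cancel] at hc
  have hmono : φ (a + k * δ) ≤ φ ((1 - q) * a + q * b) := by
    have h1 : k * δ ≤ q * (b - a) := by rw [← hδn]; nlinarith
    refine hm ⟨add_nonneg ha.1 (by positivity), ?_⟩ ⟨?_, ?_⟩ ?_ <;> nlinarith [ha.1, ha.2, hb.1, hb.2]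
  nlinarith

variable {s : ℕ} {g : (Fin s → ℝ) → ℝ}

lemma update_eq_add_single (x : Fin s → ℝ) (i : Fin s) (t : ℝ) :
    Function.update x i t = Function.update x i 0 + Pi.single i t := by
  ext j
  by_cases h : j = i
  · subst h; simp
  · simp [h]

lemma add_single_eq_update (x : Fin s → ℝ) (i : Fin s) (t : ℝ) :
    x + Pi.single i t = Function.update x i (x i + t) := by
  ext j
  by_cases h : j = i
  · subst h; simp
  · simp [h]

lemma DecreasingIncrements.componentwiseConcave (hm : MonotoneOn g (Icc 0 1))
    (hg : DecreasingIncrements g) : ComponentwiseConcave g := by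
  intro x hx i
  have hmem : ∀ t ∈ Icc (0 : ℝ) 1, Function.update x i t ∈ Icc (0 : Fin s → ℝ) 1 := by
    intro t ht
    refine ⟨fun j => ?_, fun j => ?_⟩ <;> by_cases h : j = i
    · subst h; simpa using ht.1
    · simpa [h] using hx.1 j
    · subst h; simpa using ht.2
    · simpa [h] using hx.2 j
  refine MonotoneOn.concaveOn_of_decreasing_increments ?_ ?_
  · intro a ha b hb hab
    exact hm (hmem a ha) (hmem b hb) (Function.update_mono hab)
  · intro a h k ha hh hk hs
    have h0 := hg (Function.update x i a) (Pi.single i h) (Pi.single i k)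
      (hmem a ⟨ha, by linarith⟩).1 (Pi.single_nonneg.2 hh) (Pi.single_nonneg.2 hk) (by
        have := (hmem (a + h + k) ⟨by linarith, hs⟩).2
        rwa [add_single_eq_update, add_single_eq_update, Function.update_self,
          Function.update_idem, Function.update_self, Function.update_idem])
    simpa only [add_single_eq_update, Function.update_self, Function.update_idem] using h0

/-- From the base point x ⊓ y, the two increments leading to x and to y add up to the one leading to
x ⊔ y. -/
lemma DecreasingIncrements.submodular (hg : DecreasingIncrements g) : Submodular g := by
  intro x hx y hy
  have h := hg (x ⊓ y) (x - x ⊓ y) (y - x ⊓ y) (le_inf hx.1 hy.1) (sub_nonneg.2 inf_le_left)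
    (sub_nonneg.2 inf_le_right)
  have e : x ⊓ y + (x - x ⊓ y) + (y - x ⊓ y) = x ⊔ y := by
    ext j
    simp only [Pi.add_apply, Pi.sub_apply, Pi.inf_apply, Pi.sup_apply]
    linarith [min_add_max (x j) (y j)]
  rw [e, add_sub_cancel, add_sub_cancel] at h
  linarith [h (sup_le hx.2 hy.2)]

/-- Split k into its i-th coordinate and the rest k'. The moves t eᵢ and k' have disjoint supports,
so submodularity exchanges them; concavity along eᵢ, starting from u + k', then accounts for k i. -/
lemma decreasingIncrements_single (hc : ComponentwiseConcave g) (hs : Submodular g)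
    (i : Fin s) {t : ℝ} (ht : 0 ≤ t) {u k : Fin s → ℝ} (hu : 0 ≤ u) (hk : 0 ≤ k)
    (h1 : u + Pi.single i t + k ≤ 1) :
    g (u + Pi.single i t + k) + g u ≤ g (u + Pi.single i t) + g (u + k) := by
  have ht' : (0 : Fin s → ℝ) ≤ Pi.single i t := Pi.single_nonneg.2 ht
  set k' := Function.update k i 0 with hk'
  have hkk : k' + Pi.single i (k i) = k := by
    rw [hk', ← update_eq_add_single, Function.update_eq_self]
  have hk0 : 0 ≤ k' := fun j => by
    by_cases h : j = i
    · subst h; simp [hk']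
    · simpa [hk', h] using hk j
  have hk1 : k' ≤ k := fun j => by
    by_cases h : j = i
    · subst h; simpa [hk'] using hk j
    · simp [hk', h]
  have hle1 : u + Pi.single i t ≤ 1 := (le_add_of_nonneg_right hk).trans h1
  have hle2 : u + k' ≤ 1 := (add_le_add_right (hk1) u).trans
    ((add_le_add_left (le_add_of_nonneg_right ht') k).trans h1)
  have hle2' : u + k ≤ 1 := (add_le_add_left (le_add_of_nonneg_right ht') k).trans h1
  have hle3 : u + Pi.single i t + k' ≤ 1 := (add_le_add_right hk1 _).trans h1
  have hA := hs (u + Pi.single i t) ⟨add_nonneg hu ht', hle1⟩ (u + k') ⟨add_nonneg hu hk0, hle2⟩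
  have e1 : (u + Pi.single i t) ⊓ (u + k') = u := by
    rw [← add_inf, show Pi.single i t ⊓ k' = 0 from ?_, add_zero]
    ext j
    by_cases h : j = i
    · subst h; simp [hk', ht]
    · simpa [hk', h] using hk j
  have e2 : (u + Pi.single i t) ⊔ (u + k') = u + Pi.single i t + k' := by
    rw [← add_sup, add_assoc, show Pi.single i t ⊔ k' = Pi.single i t + k' from ?_]
    ext j
    by_cases h : j = i
    · subst h; simp [hk', ht]
    · simpa [hk', h] using hk j
  rw [e1, e2] at hA
  have hB := (hc (u + k') ⟨add_nonneg hu hk0, hle2⟩ i).add_le_add_of_nonneg (a := (u + k') i)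
    ht (hk i) ⟨add_nonneg (hu i) (hk0 i), hle2 i⟩ ⟨?_, ?_⟩
  · simp only [Function.update_eq_self] at hB
    have e3 : Function.update (u + k') i ((u + k') i + t + k i) = u + Pi.single i t + k := by
      rw [add_assoc, ← add_single_eq_update, Pi.single_add]
      conv_rhs => rw [← hkk]
      abel
    have e4 : Function.update (u + k') i ((u + k') i + t) = u + Pi.single i t + k' := by
      rw [← add_single_eq_update]; abel
    have e5 : Function.update (u + k') i ((u + k') i + k i) = u + k := by
      rw [← add_single_eq_update, add_assoc, hkk]
    rw [e3, e4, e5] at hB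
    linarith
  · exact add_nonneg (add_nonneg (add_nonneg (hu i) (hk0 i)) ht) (hk i)
  · have := h1 i
    simp [hk'] at this ⊢
    linarith

/-- The increment h is built up one coordinate at a time, and the single-coordinate inequalities
telescope. -/
lemma decreasingIncrements_of_submodular (hc : ComponentwiseConcave g) (hs : Submodular g) :
    DecreasingIncrements g := by
  intro u h k hu hh hk h1
  have key : ∀ T : Finset (Fin s),
      g (u + ∑ i ∈ T, Pi.single i (h i) + k) + g u ≤
        g (u + ∑ i ∈ T, Pi.single i (h i)) + g (u + k) := by
    intro T
    induction T using Finset.induction_on with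
    | empty => simp [add_comm]
    | insert i T hi ih =>
      have hT : (0 : Fin s → ℝ) ≤ ∑ i ∈ T, Pi.single i (h i) :=
        Finset.sum_nonneg fun i _ => Pi.single_nonneg.2 (hh i)
      have hle : ∑ j ∈ insert i T, Pi.single j (h j) ≤ h := by
        conv_rhs => rw [← Finset.univ_sum_single h]
        exact Finset.sum_le_sum_of_subset_of_nonneg (Finset.subset_univ _)
          fun i _ _ => Pi.single_nonneg.2 (hh i)
      have := decreasingIncrements_single hc hs i (hh i)
        (u := u + ∑ i ∈ T, Pi.single i (h i)) (k := k) (add_nonneg hu hT) hk (by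
          refine le_trans ?_ h1
          rw [Finset.sum_insert hi] at hle
          rw [add_assoc u, add_comm (∑ i ∈ T, _)]
          gcongr)
      rw [Finset.sum_insert hi, add_comm _ (∑ x ∈ T, _), ← add_assoc]
      linarith
  simpa [Finset.univ_sum_single] using key Finset.univ

theorem decreasingIncrements_iff (hm : MonotoneOn g (Icc 0 1)) :
    DecreasingIncrements g ↔ ComponentwiseConcave g ∧ Submodular g :=
  ⟨fun h => ⟨h.componentwiseConcave hm, h.submodular⟩,
    fun h => decreasingIncrements_of_submodular h.1 h.2⟩

end ScenarioRisk

/-! ### A majorization inequality for functions with decreasing increments -/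

namespace ScenarioRisk

/-- Abel summation: since all tail sums of d are nonpositive, lowering the weights on a tail to an
earlier weight can only increase the sum. -/
lemma sum_Ico_mul_le_of_monotone {w d : ℕ → ℝ} (hw : Monotone w) {N : ℕ}
    (hd : ∀ m ≤ N, ∑ k ∈ Finset.Ico m N, d k ≤ 0) (n m : ℕ) (hm : m + n = N) :
    ∑ k ∈ Finset.Ico m N, w k * d k ≤ w m * ∑ k ∈ Finset.Ico m N, d k := by
  induction n generalizing m with
  | zero => obtain rfl : m = N := by omega
            simp
  | succ n ih =>
    have h := ih (m + 1) (by omega)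
    have h1 := mul_le_mul_of_nonpos_right (hw (Nat.le_succ m)) (hd (m + 1) (by omega))
    have hlt : m < N := by omega
    rw [Finset.sum_eq_sum_Ico_succ_bot hlt, Finset.sum_eq_sum_Ico_succ_bot hlt d, mul_add]
    simp only [Nat.succ_eq_add_one] at h1
    linarith

lemma _root_.ConcaveOn.slope_le_slope_of_le {φ : ℝ → ℝ} {D : Set ℝ} (hφ : ConcaveOn ℝ D φ)
    {a b c d : ℝ} (ha : a ∈ D) (hd : d ∈ D) (hab : a < b) (hbc : b ≤ c) (hcd : c < d) :
    (φ d - φ c) / (d - c) ≤ (φ b - φ a) / (b - a) := by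
  have hc : c ∈ D := hφ.1.ordConnected.out ha hd ⟨by linarith, hcd.le⟩
  have hb : b ∈ D := hφ.1.ordConnected.out ha hd ⟨hab.le, by linarith⟩
  rcases hbc.eq_or_lt with rfl | hbc
  · exact hφ.slope_anti_adjacent ha hd hab hcd
  · exact (hφ.slope_anti_adjacent hb hd hbc hcd).trans (hφ.slope_anti_adjacent ha hc hab hbc)

variable {s : ℕ} {g : (Fin s → ℝ) → ℝ}

lemma update_mem_cube {x : Fin s → ℝ} (hx : x ∈ Icc (0 : Fin s → ℝ) 1) (i : Fin s) {t : ℝ}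
    (ht : t ∈ Icc (0 : ℝ) 1) : Function.update x i t ∈ Icc (0 : Fin s → ℝ) 1 := by
  refine ⟨fun j => ?_, fun j => ?_⟩ <;> by_cases h : j = i
  · subst h; simpa using ht.1
  · simpa [h] using hx.1 j
  · subst h; simpa using ht.2
  · simpa [h] using hx.2 j

/-- The increment in one coordinate decreases when all other coordinates increase. -/
lemma DecreasingIncrements.update_sub_le (hg : DecreasingIncrements g) {x y : Fin s → ℝ}
    (hx : x ∈ Icc (0 : Fin s → ℝ) 1) (hy : y ∈ Icc (0 : Fin s → ℝ) 1) (hxy : x ≤ y) (i : Fin s)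
    {a b : ℝ} (ha : 0 ≤ a) (hab : a ≤ b) (hb : b ≤ 1) :
    g (Function.update y i b) - g (Function.update y i a) ≤
      g (Function.update x i b) - g (Function.update x i a) := by
  have h := hg (Function.update x i a) (Pi.single i (b - a))
    (Function.update y i a - Function.update x i a)
    (update_mem_cube hx i ⟨ha, hab.trans hb⟩).1 (Pi.single_nonneg.2 (sub_nonneg.2 hab))
    (sub_nonneg.2 (update_le_update_iff.2 ⟨le_rfl, fun j _ => hxy j⟩))
  have e : Function.update x i a + Pi.single i (b - a) = Function.update x i b := by
    rw [add_single_eq_update]; simp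
  have e' : Function.update x i a + Pi.single i (b - a) +
      (Function.update y i a - Function.update x i a) = Function.update y i b := by
    rw [add_right_comm, add_sub_cancel, add_single_eq_update]; simp
  rw [e', e, add_sub_cancel] at h
  linarith [h (update_mem_cube hy i ⟨ha.trans hab, hb⟩).2]

/-- Two decreasing sequences in the cube that differ in a single coordinate. -/
lemma DecreasingIncrements.sum_le_sum_of_single (hm : MonotoneOn g (Icc 0 1))
    (hg : DecreasingIncrements g) (i : Fin s) {p q : ℕ → Fin s → ℝ} {N : ℕ}
    (hp : ∀ k, p k ∈ Icc (0 : Fin s → ℝ) 1) (hq : ∀ k, q k ∈ Icc (0 : Fin s → ℝ) 1)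
    (hqa : Antitone q) (hne : ∀ k j, j ≠ i → p k j = q k j)
    (htail : ∀ m ≤ N, ∑ k ∈ Finset.Ico m N, p k i ≤ ∑ k ∈ Finset.Ico m N, q k i) :
    ∑ k ∈ Finset.range N, g (p k) ≤ ∑ k ∈ Finset.range N, g (q k) := by
  have hpu : ∀ k, p k = Function.update (q k) i (p k i) := fun k => by
    ext j
    by_cases h : j = i
    · subst h; simp
    · simp [h, hne k j h]
  have hpq : ∀ k, p k i ≤ q k i → p k ≤ q k := fun k hk j => by
    by_cases h : j = i
    · subst h; exact hk
    · exact (hne k j h).le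
  have hqp : ∀ k, q k i ≤ p k i → q k ≤ p k := fun k hk j => by
    by_cases h : j = i
    · subst h; exact hk
    · exact (hne k j h).ge
  -- Difference quotients of g at the indices where p exceeds q, and 0 elsewhere. Their running
  -- maximum w is a monotone sequence of nonnegative weights that dominates every such quotient.
  set f : ℕ → ℝ := fun k => if q k i < p k i then (g (p k) - g (q k)) / (p k i - q k i) else 0
    with hf
  have hf0 : ∀ k, 0 ≤ f k := fun k => by
    simp only [hf]
    split_ifs with h
    · exact div_nonneg (sub_nonneg.2 (hm (hq k) (hp k) (hqp k h.le))) (sub_nonneg.2 h.le)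
    · exact le_rfl
  set w : ℕ →o ℝ := partialSups f with hw
  have hw0 : 0 ≤ w 0 := (hf0 0).trans (le_partialSups f 0)
  have hdown : ∀ m, p m i < q m i → w m ≤ (g (q m) - g (p m)) / (q m i - p m i) := by
    intro m hlt
    refine partialSups_le f m _ fun k hkm => ?_
    simp only [hf]
    split_ifs with h
    -- In coordinate i, p m < q m ≤ q k < p k. Concavity on the line through q k compares the two
    -- slopes; lowering the other coordinates from those of q k to those of q m only enlarges the
    -- increment over [p m, q m].
    · have h1 := (hg.componentwiseConcave hm (q k) (hq k) i).slope_le_slope_of_le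
        (a := p m i) (b := q m i) (c := q k i) (d := p k i) ⟨(hp m).1 i, (hp m).2 i⟩
        ⟨(hp k).1 i, (hp k).2 i⟩ hlt (hqa hkm i) h
      simp only [Function.update_eq_self, ← hpu] at h1
      refine h1.trans (div_le_div_of_nonneg_right ?_ (sub_nonneg.2 hlt.le))
      have h2 := hg.update_sub_le (hq m) (hq k) (hqa hkm) i ((hp m).1 i) hlt.le ((hq m).2 i)
      rwa [← hpu, Function.update_eq_self] at h2
    · exact div_nonneg (sub_nonneg.2 (hm (hp m) (hq m) (hpq m hlt.le))) (sub_nonneg.2 hlt.le)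
  have hterm : ∀ k, g (p k) - g (q k) ≤ w k * (p k i - q k i) := by
    intro k
    rcases lt_trichotomy (p k i) (q k i) with h | h | h
    · have := hdown k h
      rw [le_div_iff₀ (sub_pos.2 h)] at this
      linarith
    · rw [hpu k, h]; simp
    · have h1 : f k ≤ w k := le_partialSups f k
      have h2 : f k = (g (p k) - g (q k)) / (p k i - q k i) := by simp [hf, h]
      rwa [h2, div_le_iff₀ (sub_pos.2 h)] at h1
  have hd : ∀ m ≤ N, ∑ k ∈ Finset.Ico m N, (p k i - q k i) ≤ 0 := fun m hmN => by
    rw [Finset.sum_sub_distrib]; linarith [htail m hmN]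
  have h1 := sum_Ico_mul_le_of_monotone w.monotone hd N 0 (by simp)
  have h2 := mul_nonpos_of_nonneg_of_nonpos hw0 (hd 0 N.zero_le)
  have h3 := Finset.sum_le_sum fun k (_ : k ∈ Finset.Ico 0 N) => hterm k
  rw [Finset.sum_sub_distrib, ← Finset.range_eq_Ico] at h3
  rw [← Finset.range_eq_Ico] at h1 h2
  linarith

/-- The coordinates of p are replaced by those of q one after another. The mixed sequences remain
decreasing, and each replacement is an instance of the single-coordinate case. -/
theorem DecreasingIncrements.sum_le_sum (hm : MonotoneOn g (Icc 0 1))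
    (hg : DecreasingIncrements g) {p q : ℕ → Fin s → ℝ} {N : ℕ}
    (hp : ∀ k, p k ∈ Icc (0 : Fin s → ℝ) 1) (hq : ∀ k, q k ∈ Icc (0 : Fin s → ℝ) 1)
    (hpa : Antitone p) (hqa : Antitone q)
    (htail : ∀ i, ∀ m ≤ N, ∑ k ∈ Finset.Ico m N, p k i ≤ ∑ k ∈ Finset.Ico m N, q k i) :
    ∑ k ∈ Finset.range N, g (p k) ≤ ∑ k ∈ Finset.range N, g (q k) := by
  classical
  set z : Finset (Fin s) → ℕ → Fin s → ℝ := fun T k j => if j ∈ T then q k j else p k j with hz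
  have hzmem : ∀ T k, z T k ∈ Icc (0 : Fin s → ℝ) 1 := fun T k => by
    refine ⟨fun j => ?_, fun j => ?_⟩ <;> by_cases h : j ∈ T <;> simp only [hz, h, if_true, if_false]
    exacts [(hq k).1 j, (hp k).1 j, (hq k).2 j, (hp k).2 j]
  have hza : ∀ T, Antitone (z T) := fun T k l hkl j => by
    by_cases h : j ∈ T <;> simp only [hz, h, if_true, if_false]
    exacts [hqa hkl j, hpa hkl j]
  have key : ∀ T, ∑ k ∈ Finset.range N, g (p k) ≤ ∑ k ∈ Finset.range N, g (z T k) := by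
    intro T
    induction T using Finset.induction_on with
    | empty => simp [hz]
    | insert i T hi ih =>
      refine ih.trans (hg.sum_le_sum_of_single hm i (hzmem _) (hzmem _) (hza _) ?_ ?_)
      · intro k j hj
        simp [hz, hj]
      · intro m hmN
        simpa [hz, hi] using htail i m hmN
  simpa [hz] using key Finset.univ

end ScenarioRisk

/-! ### Atomless spaces: intermediate values, uniform variables, prescribed conditional laws -/

namespace ScenarioRisk

section Atomless

variable {Ω : Type*} [MeasurableSpace Ω] {Q : Measure Ω} [IsFiniteMeasure Q]

/-- Of a proper part and its complement in A, one has at most half the mass. -/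
lemma Atomless.exists_half_subset (hQ : Atomless Q) {A : Set Ω} (hA : MeasurableSet A)
    (h0 : 0 < Q.real A) :
    ∃ B ⊆ A, MeasurableSet B ∧ 0 < Q.real B ∧ Q.real B ≤ Q.real A / 2 := by
  obtain ⟨B, hBA, hB, hB0, hBA'⟩ := hQ A hA (by
    rw [measureReal_def, ENNReal.toReal_pos_iff] at h0; exact h0.1)
  have h1 : 0 < Q.real B := ENNReal.toReal_pos hB0.ne' (measure_ne_top _ _)
  have h2 : Q.real B < Q.real A :=
    (ENNReal.toReal_lt_toReal (measure_ne_top _ _) (measure_ne_top _ _)).2 hBA'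
  have h3 : Q.real (A \ B) = Q.real A - Q.real B := measureReal_sdiff hBA hB
  by_cases h : Q.real B ≤ Q.real A / 2
  · exact ⟨B, hBA, hB, h1, h⟩
  · exact ⟨A \ B, sdiff_subset, hA.diff hB, by linarith, by linarith⟩

lemma Atomless.exists_small_subset (hQ : Atomless Q) {A : Set Ω} (hA : MeasurableSet A)
    (h0 : 0 < Q.real A) {ε : ℝ} (hε : 0 < ε) :
    ∃ B ⊆ A, MeasurableSet B ∧ 0 < Q.real B ∧ Q.real B ≤ ε := by
  have key : ∀ n : ℕ, ∃ B ⊆ A, MeasurableSet B ∧ 0 < Q.real B ∧ Q.real B ≤ Q.real A * (1 / 2) ^ n := by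
    intro n
    induction n with
    | zero => exact ⟨A, subset_rfl, hA, h0, by simp⟩
    | succ n ih =>
      obtain ⟨B, hBA, hB, hB0, hBn⟩ := ih
      obtain ⟨C, hCB, hC, hC0, hCn⟩ := hQ.exists_half_subset hB hB0
      exact ⟨C, hCB.trans hBA, hC, hC0, by rw [pow_succ]; linarith⟩
  obtain ⟨n, hn⟩ := exists_pow_lt_of_lt_one (div_pos hε h0) (show (1 / 2 : ℝ) < 1 by norm_num)
  obtain ⟨B, hBA, hB, hB0, hBn⟩ := key n
  refine ⟨B, hBA, hB, hB0, hBn.trans ?_⟩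
  rw [lt_div_iff₀ h0] at hn
  linarith

/-- Sierpiński's theorem: an atomless finite measure takes all intermediate values. -/
theorem Atomless.exists_between (hQ : Atomless Q) {A C : Set Ω} (hA : MeasurableSet A)
    (hC : MeasurableSet C) (hAC : A ⊆ C) {c : ℝ} (h1 : Q.real A ≤ c) (h2 : c ≤ Q.real C) :
    ∃ B, MeasurableSet B ∧ A ⊆ B ∧ B ⊆ C ∧ Q.real B = c := by
  set σ : Set (Set Ω) := {B | MeasurableSet B ∧ A ⊆ B ∧ B ⊆ C ∧ Q.real B ≤ c} with hσ
  -- Greedy choice: each enlargement realizes at least half of the gain in mass still available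
  -- under the bound c.
  have step : ∀ B : σ, ∃ B' : σ, B.1 ⊆ B'.1 ∧ ∀ D ∈ σ, B.1 ⊆ D →
      Q.real D - Q.real B.1 ≤ 2 * (Q.real B'.1 - Q.real B.1) := by
    intro B
    set T : Set ℝ := {x | ∃ D ∈ σ, B.1 ⊆ D ∧ Q.real D = x} with hT
    have hbdd : BddAbove T := ⟨c, by rintro x ⟨D, hD, -, rfl⟩; exact hD.2.2.2⟩
    have hle : ∀ D ∈ σ, B.1 ⊆ D → Q.real D ≤ sSup T := fun D hD hBD =>
      le_csSup hbdd ⟨D, hD, hBD, rfl⟩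
    rcases (hle B.1 B.2 subset_rfl).eq_or_lt with h | h
    · refine ⟨B, subset_rfl, fun D hD hBD => ?_⟩
      have := hle D hD hBD
      linarith
    · obtain ⟨x, ⟨D', hD', hBD', rfl⟩, hx⟩ := exists_lt_of_lt_csSup
        (show T.Nonempty from ⟨_, B.1, B.2, subset_rfl, rfl⟩) (show (Q.real B.1 + sSup T) / 2 < sSup T by linarith)
      refine ⟨⟨D', hD'⟩, hBD', fun D hD hBD => ?_⟩
      have := hle D hD hBD
      simp only
      linarith
  choose next hsub hnext using step
  set B : ℕ → σ := fun n => next^[n] ⟨A, hA, subset_rfl, hAC, h1⟩ with hB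
  have hBs : ∀ n, B (n + 1) = next (B n) := fun n => Function.iterate_succ_apply' _ _ _
  have hmono : Monotone fun n => (B n).1 := monotone_nat_of_le_succ fun n => by
    rw [hBs]; exact hsub _
  set U := ⋃ n, (B n).1 with hU
  have hUm : MeasurableSet U := MeasurableSet.iUnion fun n => (B n).2.1
  have htend : Tendsto (fun n => Q.real (B n).1) atTop (𝓝 (Q.real U)) :=
    (ENNReal.tendsto_toReal (measure_ne_top _ _)).comp (tendsto_measure_iUnion_atTop hmono)
  have hUc : Q.real U ≤ c := le_of_tendsto' htend fun n => (B n).2.2.2.2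
  have hUC : U ⊆ C := iUnion_subset fun n => (B n).2.2.2.1
  refine ⟨U, hUm, (B 0).2.2.1.trans (subset_iUnion (fun n => (B n).1) 0), hUC, ?_⟩
  refine hUc.antisymm (not_lt.1 fun hlt => ?_)
  have h3 : Q.real (C \ U) = Q.real C - Q.real U := measureReal_sdiff hUC hUm
  obtain ⟨E, hEs, hE, hE0, hEc⟩ := hQ.exists_small_subset (hC.diff hUm)
    (by linarith) (sub_pos.2 hlt)
  -- If the limit U fell short of c, the small set E could have been added at every stage, so every
  -- gain would be at least half its mass. The gains tend to 0.
  have hbound : ∀ n, Q.real E ≤ 2 * (Q.real (B (n + 1)).1 - Q.real (B n).1) := by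
    intro n
    have hBU : (B n).1 ⊆ U := subset_iUnion (fun n => (B n).1) n
    have hdis : Disjoint (B n).1 E := disjoint_left.2 fun x hx hxE => (hEs hxE).2 (hBU hx)
    have hun : Q.real ((B n).1 ∪ E) = Q.real (B n).1 + Q.real E := measureReal_union hdis hE
    have hle : Q.real (B n).1 ≤ Q.real U := measureReal_mono hBU
    have := hnext (B n) ((B n).1 ∪ E) ⟨(B n).2.1.union hE, (B n).2.2.1.trans subset_union_left,
      union_subset (B n).2.2.2.1 (hEs.trans sdiff_subset), by linarith⟩ subset_union_left
    rw [hBs]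
    linarith
  have hlim : Tendsto (fun n => 2 * (Q.real (B (n + 1)).1 - Q.real (B n).1)) atTop (𝓝 0) := by
    simpa using ((htend.comp (tendsto_add_atTop_nat 1)).sub htend).const_mul 2
  exact hE0.not_ge (ge_of_tendsto' hlim hbound)

end Atomless

section Uniform

variable {Ω : Type*} [MeasurableSpace Ω] {Q : Measure Ω} [IsProbabilityMeasure Q]

lemma Atomless.exists_refinement (hQ : Atomless Q) (F : ℕ → Set Ω)
    (hF : (∀ k, MeasurableSet (F k)) ∧ Monotone F) :
    ∃ F' : ℕ → Set Ω, ((∀ k, MeasurableSet (F' k)) ∧ Monotone F') ∧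
      (∀ k, F' (2 * k) = F k) ∧
      ∀ k, Q.real (F' (2 * k + 1)) = (Q.real (F k) + Q.real (F (k + 1))) / 2 := by
  have hmid : ∀ k, ∃ B, MeasurableSet B ∧ F k ⊆ B ∧ B ⊆ F (k + 1) ∧
      Q.real B = (Q.real (F k) + Q.real (F (k + 1))) / 2 := fun k => by
    have hsub := hF.2 (Nat.le_succ k)
    have := measureReal_mono (μ := Q) hsub
    simp only [Nat.succ_eq_add_one] at this
    exact hQ.exists_between (hF.1 k) (hF.1 (k + 1)) hsub (by linarith) (by linarith)
  choose B hBm hB1 hB2 hB3 using hmid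
  refine ⟨fun k => if k % 2 = 0 then F (k / 2) else B (k / 2), ⟨fun k => ?_, ?_⟩, fun k => ?_,
    fun k => ?_⟩
  · dsimp only
    split_ifs
    exacts [hF.1 _, hBm _]
  · refine monotone_nat_of_le_succ fun k => ?_
    rcases Nat.even_or_odd' k with ⟨m, rfl | rfl⟩
    · have e1 : (2 * m + 1) % 2 = 1 := by omega
      have e2 : (2 * m + 1) / 2 = m := by omega
      simpa [e1, e2] using hB1 m
    · have e1 : (2 * m + 1 + 1) % 2 = 0 := by omega
      have e2 : (2 * m + 1 + 1) / 2 = m + 1 := by omega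
      have e3 : (2 * m + 1) % 2 = 1 := by omega
      have e4 : (2 * m + 1) / 2 = m := by omega
      simpa [e1, e2, e3, e4] using hB2 m
  · simp
  · have e3 : (2 * k + 1) % 2 = 1 := by omega
    have e4 : (2 * k + 1) / 2 = k := by omega
    simpa [e3, e4] using hB3 k

/-- A chain of events indexed by the dyadic rationals of `[0,1]`. -/
lemma Atomless.exists_dyadic_chain (hQ : Atomless Q) :
    ∃ F : ℕ → ℕ → Set Ω, (∀ n k, MeasurableSet (F n k)) ∧ (∀ n, Monotone (F n)) ∧
      (∀ n m k, F (n + m) (2 ^ m * k) = F n k) ∧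
      ∀ n k, k ≤ 2 ^ n → Q.real (F n k) = k / 2 ^ n := by
  set σ := {F : ℕ → Set Ω // (∀ k, MeasurableSet (F k)) ∧ Monotone F}
  have step : ∀ F : σ, ∃ F' : σ, (∀ k, F'.1 (2 * k) = F.1 k) ∧
      ∀ k, Q.real (F'.1 (2 * k + 1)) = (Q.real (F.1 k) + Q.real (F.1 (k + 1))) / 2 := fun F => by
    obtain ⟨F', h1, h2⟩ := hQ.exists_refinement F.1 F.2
    exact ⟨⟨F', h1⟩, h2⟩
  choose next hev hodd using step
  set F : ℕ → σ := fun n => next^[n] ⟨fun k => if k = 0 then ∅ else univ, fun k => by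
    dsimp only; split_ifs <;> simp, monotone_nat_of_le_succ fun k => by simp⟩ with hF
  have hFs : ∀ n, F (n + 1) = next (F n) := fun n => Function.iterate_succ_apply' _ _ _
  refine ⟨fun n => (F n).1, fun n => (F n).2.1, fun n => (F n).2.2, ?_, ?_⟩
  · intro n m
    induction m with
    | zero => simp
    | succ m ih =>
      intro k
      rw [← add_assoc]
      dsimp only
      rw [hFs, pow_succ', mul_assoc, hev]
      exact ih k
  · intro n
    induction n with
    | zero =>
      intro k hk
      have hk' : k = 0 ∨ k = 1 := by simp at hk; omega
      rcases hk' with rfl | rfl <;> simp [hF]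
    | succ n ih =>
      intro k hk
      rw [pow_succ] at hk
      dsimp only
      rw [hFs]
      rcases Nat.even_or_odd' k with ⟨m, rfl | rfl⟩
      · rw [hev, ih m (by omega)]
        push_cast
        rw [pow_succ]
        field_simp
      · rw [hodd, ih m (by omega), ih (m + 1) (by omega)]
        push_cast
        rw [pow_succ]
        field_simp
        ring

/-- An atomless probability space carries a uniformly distributed random variable. -/
theorem Atomless.exists_uniform (hQ : Atomless Q) :
    ∃ U : Ω → unitInterval, Measurable U ∧ Q.map U = volume := by
  obtain ⟨F, hFm, hFmono, hFr, hFQ⟩ := hQ.exists_dyadic_chain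
  have hcomp : ∀ n k m l : ℕ, (k : ℝ) / 2 ^ n ≤ l / 2 ^ m → F n k ⊆ F m l := by
    intro n k m l h
    rw [div_le_div_iff₀ (by positivity) (by positivity)] at h
    rw [← hFr n m k, ← hFr m n l, add_comm m n]
    refine hFmono _ ?_
    have : ((2 ^ m * k : ℕ) : ℝ) ≤ (2 ^ n * l : ℕ) := by push_cast; linarith
    exact_mod_cast this
  -- V(ω) is the infimum of the dyadic levels whose event contains ω; inserting 1 makes the set
  -- nonempty and bounds V by 1.
  set T : Ω → Set ℝ := fun ω => insert 1 {x | ∃ n k : ℕ, ω ∈ F n k ∧ x = k / 2 ^ n} with hT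
  have hT0 : ∀ ω, ∀ x ∈ T ω, 0 ≤ x := by
    rintro ω x (rfl | ⟨n, k, -, rfl⟩) <;> positivity
  have hbdd : ∀ ω, BddBelow (T ω) := fun ω => ⟨0, fun x hx => hT0 ω x hx⟩
  have hne : ∀ ω, (T ω).Nonempty := fun ω => ⟨1, mem_insert _ _⟩
  set V : Ω → ℝ := fun ω => sInf (T ω) with hV
  have hVI : ∀ ω, V ω ∈ unitInterval := fun ω =>
    ⟨le_csInf (hne ω) (hT0 ω), csInf_le (hbdd ω) (mem_insert _ _)⟩
  have hlt : ∀ t ≤ 1, {ω | V ω < t} = ⋃ (n : ℕ) (k : ℕ) (_ : (k : ℝ) / 2 ^ n < t), F n k := by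
    intro t ht
    ext ω
    simp only [mem_ofPred_eq, mem_iUnion, hV, csInf_lt_iff (hbdd ω) (hne ω)]
    constructor
    · rintro ⟨x, rfl | ⟨n, k, h, rfl⟩, hx⟩
      · linarith
      · exact ⟨n, k, hx, h⟩
    · rintro ⟨n, k, hx, h⟩
      exact ⟨_, Or.inr ⟨n, k, h, rfl⟩, hx⟩
  have hltm : ∀ t ≤ 1, MeasurableSet {ω | V ω < t} := fun t ht => by
    rw [hlt t ht]
    exact .iUnion fun n => .iUnion fun k => .iUnion fun _ => hFm n k
  have hVm : Measurable V := measurable_of_Iio fun t => by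
    rcases le_or_gt t 1 with ht | ht
    · exact hltm t ht
    · rw [show V ⁻¹' Iio t = univ from eq_univ_of_forall fun ω => (hVI ω).2.trans_lt ht]
      exact .univ
  have hprob : ∀ t ∈ unitInterval, Q.real {ω | V ω < t} = t := by
    intro t ht
    have hub : ∀ n k : ℕ, k ≤ 2 ^ n → t ≤ k / 2 ^ n → Q.real {ω | V ω < t} ≤ k / 2 ^ n := by
      intro n k hk h
      rw [← hFQ n k hk]
      refine measureReal_mono ?_
      rw [hlt t ht.2]
      exact iUnion_subset fun m => iUnion_subset fun l => iUnion_subset fun hl =>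
        hcomp _ _ _ _ (hl.le.trans h)
    have hlb : ∀ n k : ℕ, k ≤ 2 ^ n → (k : ℝ) / 2 ^ n < t → k / 2 ^ n ≤ Q.real {ω | V ω < t} := by
      intro n k hk h
      rw [← hFQ n k hk]
      refine measureReal_mono ?_
      rw [hlt t ht.2]
      exact subset_iUnion_of_subset n (subset_iUnion_of_subset k (subset_iUnion_of_subset h
        subset_rfl))
    have hpow : Tendsto (fun n : ℕ => (1 / 2 : ℝ) ^ n) atTop (𝓝 0) :=
      tendsto_pow_atTop_nhds_zero_of_lt_one (by norm_num) (by norm_num)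
    have hceil : ∀ n : ℕ, ⌈t * 2 ^ n⌉₊ ≤ 2 ^ n := fun n => by
      rw [Nat.ceil_le]
      push_cast
      exact mul_le_of_le_one_left (by positivity) ht.2
    have hdiv : ∀ n : ℕ, (1 / 2 : ℝ) ^ n = 1 / 2 ^ n := fun n => by rw [div_pow, one_pow]
    refine le_antisymm ?_ ?_
    · refine ge_of_tendsto' (x := atTop) (a := t) (f := fun n : ℕ => t + (1 / 2 : ℝ) ^ n) ?_ fun n => ?_
      · simpa using hpow.const_add t
      · refine (hub n ⌈t * 2 ^ n⌉₊ (hceil n) ?_).trans ?_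
        · rw [le_div_iff₀ (by positivity)]
          exact Nat.le_ceil _
        · have := (Nat.ceil_lt_add_one (mul_nonneg ht.1 (show (0 : ℝ) ≤ 2 ^ n by positivity))).le
          rw [hdiv, div_le_iff₀ (by positivity), add_mul, one_div, inv_mul_cancel₀ (by positivity)]
          exact this
    · refine le_of_tendsto' (x := atTop) (b := Q.real {ω | V ω < t}) (f := fun n : ℕ => t - (1 / 2 : ℝ) ^ n) ?_
        fun n => ?_
      · simpa using hpow.const_sub t
      · rcases Nat.eq_zero_or_pos ⌈t * 2 ^ n⌉₊ with h0 | h0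
        · have : t * 2 ^ n ≤ 0 := Nat.ceil_eq_zero.1 h0
          have h2 : (0 : ℝ) < 2 ^ n := by positivity
          have h3 : (0 : ℝ) < (1 / 2) ^ n := by positivity
          have h4 : 0 ≤ Q.real {ω | V ω < t} := measureReal_nonneg
          nlinarith
        · have h1 : ((⌈t * 2 ^ n⌉₊ - 1 : ℕ) : ℝ) < t * 2 ^ n :=
            Nat.lt_ceil.1 (Nat.sub_lt h0 one_pos)
          refine le_trans ?_ (hlb n (⌈t * 2 ^ n⌉₊ - 1) ((Nat.sub_le _ _).trans (hceil n)) ?_)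
          · rw [hdiv, le_div_iff₀ (by positivity), sub_mul, one_div,
              inv_mul_cancel₀ (by positivity), Nat.cast_sub h0]
            push_cast
            linarith [Nat.le_ceil (t * 2 ^ n)]
          · rwa [div_lt_iff₀ (by positivity)]
  have hUm : Measurable fun ω => (⟨V ω, hVI ω⟩ : unitInterval) := hVm.subtype_mk
  refine ⟨_, hUm, ?_⟩
  have : IsProbabilityMeasure (Q.map fun ω => (⟨V ω, hVI ω⟩ : unitInterval)) :=
    Measure.isProbabilityMeasure_map hUm.aemeasurable
  refine Measure.ext_of_Ici _ _ fun t => ?_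
  rw [Measure.map_apply hUm measurableSet_Ici, unitInterval.volume_Ici,
    ← ofReal_measureReal (measure_ne_top _ _)]
  congr 1
  rw [show (fun ω => (⟨V ω, hVI ω⟩ : unitInterval)) ⁻¹' Ici t = {ω | V ω < t}ᶜ from ?_,
    probReal_compl_eq_one_sub (hltm _ t.2.2), hprob _ t.2]
  ext ω
  simp [← Subtype.coe_le_coe]

end Uniform

section Scenarios

variable {Ω : Type*} [MeasurableSpace Ω] {P : Measure Ω} [IsProbabilityMeasure P] {s : ℕ}
  {S : Fin s → Set Ω}

lemma IsScenarios.isProbabilityMeasure_cond (hS : IsScenarios P S) (j : Fin s) :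
    IsProbabilityMeasure (P[|S j]) := cond_isProbabilityMeasure (hS.pos j).ne'

lemma IsScenarios.atomless_cond (hP : Atomless P) (hS : IsScenarios P S) (j : Fin s) :
    Atomless (P[|S j]) := by
  intro A hA hA0
  obtain ⟨B, hBA, hB, hB0, hBlt⟩ := hP (S j ∩ A) ((hS.measurableSet j).inter hA)
    (inter_pos_of_cond_ne_zero (hS.measurableSet j) hA0.ne')
  have hc0 : (P (S j))⁻¹ ≠ 0 := ENNReal.inv_ne_zero.2 (measure_ne_top _ _)
  have hct : (P (S j))⁻¹ ≠ ⊤ := ENNReal.inv_ne_top.2 (hS.pos j).ne'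
  have e : S j ∩ B = B := inter_eq_right.2 (hBA.trans inter_subset_left)
  refine ⟨B, hBA.trans inter_subset_right, hB, ?_, ?_⟩
  · rw [cond_apply (hS.measurableSet j), e]
    exact ENNReal.mul_pos hc0 hB0.ne'
  · rw [cond_apply (hS.measurableSet j), cond_apply (hS.measurableSet j), e]
    exact (ENNReal.mul_lt_mul_iff_right hc0 hct).2 hBlt

omit [IsProbabilityMeasure P] in
lemma IsScenarios.exists_index (hS : IsScenarios P S) :
    ∃ J : Ω → Fin s, Measurable J ∧ ∀ ω j, ω ∈ S j ↔ J ω = j := by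
  have h : ∀ ω, ∃ j, ω ∈ S j := fun ω => mem_iUnion.1 (hS.cover ▸ mem_univ ω)
  choose J hJ using h
  have hJ' : ∀ ω j, ω ∈ S j ↔ J ω = j := fun ω j => by
    refine ⟨fun hω => by_contra fun hne => ?_, fun h => h ▸ hJ ω⟩
    exact disjoint_left.1 (hS.disjoint _ _ hne) (hJ ω) hω
  refine ⟨J, measurable_to_countable' fun j => ?_, hJ'⟩
  convert hS.measurableSet j
  ext ω
  simp [hJ']

/-- Finitely many scenarios cover Ω, so almost sure statements can be checked scenario by scenario,
where J is constant. -/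
lemma ae_iff_forall_ae_cond (hS : IsScenarios P S) {p : Ω → Prop} :
    (∀ᵐ ω ∂P, p ω) ↔ ∀ j, ∀ᵐ ω ∂(P[|S j]), p ω := by
  refine ⟨fun h j => cond_absolutelyContinuous.ae_le h, fun h => ?_⟩
  rw [ae_iff] at *
  refine measure_mono_null (t := ⋃ j, (S j ∩ {ω | ¬ p ω})) ?_ (measure_iUnion_null fun j => ?_)
  · rw [← iUnion_inter, hS.cover, univ_inter]
  · have := h j
    rw [ae_iff, cond_apply (hS.measurableSet j), mul_eq_zero] at this
    exact this.resolve_left (ENNReal.inv_ne_zero.2 (measure_ne_top _ _))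

/-- Random elements with prescribed laws under each of the scenarios. -/
theorem IsScenarios.exists_map_eq (hP : Atomless P) (hS : IsScenarios P S) {E : Type*}
    [MeasurableSpace E] [StandardBorelSpace E] (μ : Fin s → Measure E)
    [∀ j, IsProbabilityMeasure (μ j)] :
    ∃ W : Ω → E, Measurable W ∧ ∀ j, (P[|S j]).map W = μ j := by
  obtain ⟨J, hJ, hJS⟩ := hS.exists_index
  have h : ∀ j, ∃ W : Ω → E, Measurable W ∧ (P[|S j]).map W = μ j := fun j => by
    have := hS.isProbabilityMeasure_cond j
    obtain ⟨U, hU, hUm⟩ := (hS.atomless_cond hP j).exists_uniform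
    have : Nonempty E := (μ j).nonempty_of_neZero
    obtain ⟨f, hf, hfm⟩ := (μ j).exists_measurable_map_eq
    exact ⟨f ∘ U, hf.comp hU, by rw [← Measure.map_map hf hU, hUm, hfm]⟩
  choose W hW hWμ using h
  have hm : Measurable fun ω => W (J ω) ω :=
    (measurable_from_prod_countable_right (f := fun x : Fin s × Ω => W x.1 x.2) hW).comp
      (hJ.prodMk measurable_id)
  refine ⟨_, hm, fun j => ?_⟩
  rw [← hWμ j]
  refine Measure.map_congr ?_
  filter_upwards [ae_cond_mem (hS.measurableSet j)] with ω hω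
  rw [(hJS ω j).1 hω]

/-- Nested events with arbitrary prescribed conditional probabilities. -/
theorem IsScenarios.exists_events (hP : Atomless P) (hS : IsScenarios P S) :
    ∃ E : (Fin s → ℝ) → Set Ω, (∀ a, MeasurableSet (E a)) ∧ Monotone E ∧
      (∀ a ∈ Icc (0 : Fin s → ℝ) 1, scenarioProb P S (E a) = a) ∧
      ∀ (a : ℕ → Fin s → ℝ) (b : Fin s → ℝ), Tendsto a atTop (𝓝 b) →
        ∀ᵐ ω ∂P, ∀ᶠ n in atTop, ω ∈ E (a n) ↔ ω ∈ E b := by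
  obtain ⟨J, hJ, hJS⟩ := hS.exists_index
  obtain ⟨U, hU, hUm⟩ := hS.exists_map_eq hP fun _ => (volume : Measure unitInterval)
  have haJ : ∀ a : Fin s → ℝ, Measurable fun ω => a (J ω) := fun a =>
    (measurable_from_top (f := a)).comp hJ
  -- The variable U is uniform under every scenario, so the j-th conditional probability is a j.
  -- Membership can be unstable as a n → b only where U = b (J ω), which is a null event.
  refine ⟨fun a => {ω | (U ω : ℝ) < a (J ω)}, fun a => measurableSet_lt hU.subtype_val (haJ a),
    fun a b hab ω hω => lt_of_lt_of_le hω (hab _), ?_, ?_⟩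
  · intro a ha
    ext j
    have h1 : (P[|S j]) {ω | (U ω : ℝ) < a (J ω)} = (P[|S j]) (U ⁻¹' Iio ⟨a j, ha.1 j, ha.2 j⟩) := by
      refine measure_congr ?_
      filter_upwards [ae_cond_mem (hS.measurableSet j)] with ω hω
      rw [hJS] at hω
      change ((U ω : ℝ) < a (J ω)) = (U ω < ⟨a j, ha.1 j, ha.2 j⟩)
      rw [hω]
      rfl
    rw [scenarioProb, measureReal_def, h1, ← Measure.map_apply hU measurableSet_Iio, hUm,
      unitInterval.volume_Iio]
    exact ENNReal.toReal_ofReal (ha.1 j)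
  · intro a b hab
    have hne : ∀ᵐ ω ∂P, (U ω : ℝ) ≠ b (J ω) := by
      rw [ae_iff_forall_ae_cond hS]
      intro j
      have h0 : ∀ᵐ ω ∂(P[|S j]), (U ω : ℝ) ≠ b j := by
        have : ∀ᵐ x : unitInterval ∂((P[|S j]).map U), (x : ℝ) ≠ b j := by
          rw [hUm]
          have hs : {x : unitInterval | (x : ℝ) = b j}.Subsingleton := fun x hx y hy =>
            Subtype.ext (hx.trans hy.symm)
          rw [ae_iff]
          simpa using hs.measure_zero volume
        exact ae_of_ae_map hU.aemeasurable this
      filter_upwards [h0, ae_cond_mem (hS.measurableSet j)] with ω h1 h2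
      rwa [(hJS ω j).1 h2]
    filter_upwards [hne] with ω hω
    have ht : Tendsto (fun n => a n (J ω)) atTop (𝓝 (b (J ω))) := (tendsto_pi_nhds.1 hab) _
    rcases lt_or_gt_of_ne hω with h | h
    · filter_upwards [ht.eventually (lt_mem_nhds h)] with n hn
      exact ⟨fun _ => h, fun _ => hn⟩
    · filter_upwards [ht.eventually (gt_mem_nhds h)] with n hn
      exact ⟨fun h' => absurd (show (U ω : ℝ) < a n (J ω) from h') hn.not_gt,
        fun h' => absurd (show (U ω : ℝ) < b (J ω) from h') h.not_gt⟩

end Scenarios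

end ScenarioRisk

/-! ### Choquet integrals with respect to capacities -/

namespace ScenarioRisk

section Choquet

variable {Ω : Type*} {ν : Set Ω → ℝ} {X Y : Ω → ℝ}

/-- A normalized monotone set function. -/
structure IsCapacity (ν : Set Ω → ℝ) : Prop where
  mono : Monotone ν
  map_empty : ν ∅ = 0
  map_univ : ν univ = 1

lemma IsCapacity.nonneg (hν : IsCapacity ν) (A : Set Ω) : 0 ≤ ν A :=
  hν.map_empty ▸ hν.mono (empty_subset A)

lemma IsCapacity.le_one (hν : IsCapacity ν) (A : Set Ω) : ν A ≤ 1 :=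
  hν.map_univ ▸ hν.mono (subset_univ A)

lemma IsCapacity.antitone (hν : IsCapacity ν) (X : Ω → ℝ) :
    Antitone fun x : ℝ => ν {ω | x < X ω} :=
  fun _ _ hxy => hν.mono fun _ hω => lt_of_le_of_lt hxy hω

lemma IsCapacity.intervalIntegrable (hν : IsCapacity ν) (X : Ω → ℝ) (a b : ℝ) :
    IntervalIntegrable (fun x : ℝ => ν {ω | x < X ω}) volume a b :=
  (hν.antitone X).intervalIntegrable

/-- The survival function is 1 below α and 0 above β, so both integrals reduce to the window [α, β];
the constant -1 integrated over [α, 0] gives α. -/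
lemma IsCapacity.choquetIntegral_eq (hν : IsCapacity ν) {α β : ℝ} (hα : α ≤ 0) (hβ : 0 ≤ β)
    (hX : ∀ ω, X ω ∈ Icc α β) :
    choquetIntegral ν X = (∫ x in α..β, ν {ω | x < X ω}) + α := by
  have h1 : ∫ x in Ioi (0 : ℝ), ν {ω | x < X ω} = ∫ x in (0 : ℝ)..β, ν {ω | x < X ω} := by
    rw [intervalIntegral.integral_of_le hβ]
    refine (setIntegral_eq_of_subset_of_forall_sdiff_eq_zero measurableSet_Ioi
      Ioc_subset_Ioi_self fun x hx => ?_).trans rfl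
    have hx' : β < x := not_le.1 fun h => hx.2 ⟨hx.1, h⟩
    rw [show {ω | x < X ω} = ∅ from ?_, hν.map_empty]
    exact eq_empty_of_forall_notMem fun ω hω => (hx'.trans hω).not_ge (hX ω).2
  have h2 : ∫ x in Iio (0 : ℝ), (ν {ω | x < X ω} - 1) =
      ∫ x in α..(0 : ℝ), (ν {ω | x < X ω} - 1) := by
    rw [intervalIntegral.integral_of_le hα, ← integral_Ico_eq_integral_Ioc]
    refine (setIntegral_eq_of_subset_of_forall_sdiff_eq_zero measurableSet_Iio
      Ico_subset_Iio_self fun x hx => ?_).trans rfl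
    have hx' : x < α := not_le.1 fun h => hx.2 ⟨h, hx.1⟩
    rw [show {ω | x < X ω} = univ from ?_, hν.map_univ, sub_self]
    exact eq_univ_of_forall fun ω => hx'.trans_le (hX ω).1
  rw [choquetIntegral, h1, h2, intervalIntegral.integral_sub (hν.intervalIntegrable X _ _)
    intervalIntegrable_const, ← intervalIntegral.integral_add_adjacent_intervals
    (hν.intervalIntegrable X α 0) (hν.intervalIntegrable X 0 β)]
  simp
  ring

lemma exists_bounds_of_abs_le {C : ℝ} (hX : ∀ ω, |X ω| ≤ C) :
    (-|C| ≤ 0 ∧ 0 ≤ |C|) ∧ ∀ ω, X ω ∈ Icc (-|C|) |C| :=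
  ⟨⟨neg_nonpos.2 (abs_nonneg C), abs_nonneg C⟩,
    fun ω => abs_le.1 ((hX ω).trans (le_abs_self C))⟩

lemma IsCapacity.choquetIntegral_mono (hν : IsCapacity ν) (hX : ∃ C, ∀ ω, |X ω| ≤ C)
    (hY : ∃ C, ∀ ω, |Y ω| ≤ C) (h : ∀ x, ν {ω | x < X ω} ≤ ν {ω | x < Y ω}) :
    choquetIntegral ν X ≤ choquetIntegral ν Y := by
  obtain ⟨C, hC⟩ := hX
  obtain ⟨D, hD⟩ := hY
  have hC' : ∀ ω, |X ω| ≤ |C| + |D| := fun ω =>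
    (hC ω).trans ((le_abs_self C).trans (le_add_of_nonneg_right (abs_nonneg D)))
  have hD' : ∀ ω, |Y ω| ≤ |C| + |D| := fun ω =>
    (hD ω).trans ((le_abs_self D).trans (le_add_of_nonneg_left (abs_nonneg C)))
  obtain ⟨h1, h2⟩ := exists_bounds_of_abs_le hC'
  obtain ⟨-, h3⟩ := exists_bounds_of_abs_le hD'
  rw [hν.choquetIntegral_eq h1.1 h1.2 h2, hν.choquetIntegral_eq h1.1 h1.2 h3]
  gcongr
  exact intervalIntegral.integral_mono_on (h1.1.trans h1.2) (hν.intervalIntegrable X _ _)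
    (hν.intervalIntegrable Y _ _) fun x _ => h x

lemma IsCapacity.choquetIntegral_add_const (hν : IsCapacity ν) (hX : ∃ C, ∀ ω, |X ω| ≤ C)
    (a : ℝ) : choquetIntegral ν (fun ω => X ω + a) = choquetIntegral ν X + a := by
  obtain ⟨C, hC⟩ := hX
  have h1 := fun ω => abs_le.1 (hC ω)
  have ha := neg_abs_le a
  have ha' := le_abs_self a
  have hc := le_abs_self C
  have hc0 := abs_nonneg C
  have ha0 := abs_nonneg a
  -- The window for X is the one for X + a moved by -a; the margin |a| keeps 0 inside both.
  rw [hν.choquetIntegral_eq (X := X) (α := -|C| - |a| - a) (β := |C| + |a| - a) (by linarith)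
      (by linarith) (fun ω => ⟨by linarith [(h1 ω).1], by linarith [(h1 ω).2]⟩),
    hν.choquetIntegral_eq (α := -|C| - |a|) (β := |C| + |a|) (by linarith)
      (by linarith) (fun ω => ⟨by linarith [(h1 ω).1], by linarith [(h1 ω).2]⟩),
    ← intervalIntegral.integral_comp_sub_right (fun x => ν {ω | x < X ω})]
  simp only [sub_lt_iff_lt_add]
  ring

lemma IsCapacity.choquetIntegral_const_mul (hν : IsCapacity ν) (hX : ∃ C, ∀ ω, |X ω| ≤ C)
    {t : ℝ} (ht : 0 < t) :
    choquetIntegral ν (fun ω => t * X ω) = t * choquetIntegral ν X := by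
  obtain ⟨C, hC⟩ := hX
  obtain ⟨h1, h2⟩ := exists_bounds_of_abs_le hC
  rw [hν.choquetIntegral_eq h1.1 h1.2 h2, hν.choquetIntegral_eq (α := t * -|C|) (β := t * |C|)
    (mul_nonpos_of_nonneg_of_nonpos ht.le h1.1) (mul_nonneg ht.le h1.2)
    (fun ω => ⟨mul_le_mul_of_nonneg_left (h2 ω).1 ht.le, mul_le_mul_of_nonneg_left (h2 ω).2 ht.le⟩),
    mul_add, ← intervalIntegral.mul_integral_comp_mul_left]
  simp only [mul_lt_mul_iff_right₀ ht]

/-- The sum of two indicators exceeds a level in (0, 1) on the union and a level in (1, 2) on the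
intersection. This is what lets subadditivity of the integral yield submodularity of ν. -/
lemma IsCapacity.choquetIntegral_indicator_add (hν : IsCapacity ν) (A B : Set Ω) :
    choquetIntegral ν (fun ω => A.indicator 1 ω + B.indicator 1 ω) = ν (A ∪ B) + ν (A ∩ B) := by
  have hind : ∀ (A : Set Ω) ω, A.indicator (1 : Ω → ℝ) ω = 0 ∧ ω ∉ A ∨
      A.indicator (1 : Ω → ℝ) ω = 1 ∧ ω ∈ A := fun A ω => by
    by_cases h : ω ∈ A <;> simp [h]
  rw [hν.choquetIntegral_eq (α := 0) (β := 2) le_rfl (by norm_num) (fun ω => by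
    rcases hind A ω with h1 | h1 <;> rcases hind B ω with h2 | h2 <;> rw [h1.1, h2.1] <;>
      norm_num), add_zero, ← intervalIntegral.integral_add_adjacent_intervals
    (hν.intervalIntegrable _ 0 1) (hν.intervalIntegrable _ 1 2)]
  congr 1
  · rw [intervalIntegral.integral_congr_Ioo_of_le (g := fun _ => ν (A ∪ B)) zero_le_one]
    · simp
    · intro x hx
      dsimp only
      congr 1
      ext ω
      rcases hind A ω with h1 | h1 <;> rcases hind B ω with h2 | h2 <;>
        simp [h1, h2, hx.1.le] <;> linarith [hx.1, hx.2]
  · rw [intervalIntegral.integral_congr_Ioo_of_le (g := fun _ => ν (A ∩ B)) one_le_two]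
    · norm_num
    · intro x hx
      dsimp only
      congr 1
      ext ω
      rcases hind A ω with h1 | h1 <;> rcases hind B ω with h2 | h2 <;>
        simp [h1, h2, hx.1.le] <;> linarith [hx.1, hx.2]

lemma IsCapacity.choquetIntegral_indicator (hν : IsCapacity ν) (A : Set Ω) :
    choquetIntegral ν (A.indicator 1) = ν A := by
  have := hν.choquetIntegral_indicator_add A ∅
  simpa [hν.map_empty] using this

lemma IsCapacity.choquetIntegral_le_sum (hν : IsCapacity ν) {N : ℕ} (hX : ∀ ω, X ω ∈ Icc 0 (N : ℝ)) :
    choquetIntegral ν X ≤ ∑ k ∈ Finset.range N, ν {ω | (k : ℝ) < X ω} := by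
  rw [hν.choquetIntegral_eq le_rfl (Nat.cast_nonneg N) hX, add_zero]
  have := AntitoneOn.integral_le_sum (x₀ := 0) (a := N) ((hν.antitone X).antitoneOn _)
  simpa using this

lemma IsCapacity.sum_le_choquetIntegral (hν : IsCapacity ν) {N : ℕ} (hX : ∀ ω, X ω ∈ Icc 0 (N : ℝ)) :
    ∑ k ∈ Finset.range N, ν {ω | ((k + 1 : ℕ) : ℝ) < X ω} ≤ choquetIntegral ν X := by
  rw [hν.choquetIntegral_eq le_rfl (Nat.cast_nonneg N) hX, add_zero]
  have := AntitoneOn.sum_le_integral (x₀ := 0) (a := N) ((hν.antitone X).antitoneOn _)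
  simpa using this

/-- The upper and lower Riemann sums with unit mesh differ by ν{X > 0} - ν{X > N}, at most 1. All
additive constants below come from this. -/
lemma IsCapacity.sum_le_sum_succ_add_one (hν : IsCapacity ν) (X : Ω → ℝ) (N : ℕ) :
    ∑ k ∈ Finset.range N, ν {ω | (k : ℝ) < X ω} ≤
      ∑ k ∈ Finset.range N, ν {ω | ((k + 1 : ℕ) : ℝ) < X ω} + 1 := by
  have h1 := Finset.sum_range_succ (fun k : ℕ => ν {ω | (k : ℝ) < X ω}) N
  have h2 := Finset.sum_range_succ' (fun k : ℕ => ν {ω | (k : ℝ) < X ω}) N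
  have h3 := hν.nonneg {ω | (N : ℝ) < X ω}
  have h4 := hν.le_one {ω | ((0 : ℕ) : ℝ) < X ω}
  linarith

end Choquet

/-! ### Subadditivity of the Choquet integral of a submodular capacity -/

section Subadditive

variable {Ω : Type*} [MeasurableSpace Ω] {ν : Set Ω → ℝ} {X Y : Ω → ℝ}

/-- Submodularity of a set function on events. -/
def SubmodularSets (ν : Set Ω → ℝ) : Prop :=
  ∀ A B : Set Ω, MeasurableSet A → MeasurableSet B → ν (A ∪ B) + ν (A ∩ B) ≤ ν A + ν B

/-- The event {k < Z + 1_A} is the union of {k < Z} and A ∩ {k ≤ Z}, which intersect in A ∩ {k + 1 ≤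
Z}. Submodularity at each level k leaves a telescoping sum that starts at ν A. -/
lemma SubmodularSets.sum_add_indicator_le (hν : IsCapacity ν) (hs : SubmodularSets ν) {Z : Ω → ℕ}
    (hZ : Measurable Z) {A : Set Ω} (hA : MeasurableSet A) (M : ℕ) :
    ∑ k ∈ Finset.range M, ν {ω | k < Z ω + A.indicator 1 ω} ≤
      ∑ k ∈ Finset.range M, ν {ω | k < Z ω} + ν A := by
  have h : ∀ k : ℕ, ν {ω | k < Z ω + A.indicator 1 ω} ≤
      ν {ω | k < Z ω} + (ν (A ∩ {ω | k ≤ Z ω}) - ν (A ∩ {ω | k + 1 ≤ Z ω})) := by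
    intro k
    have h1 := hs {ω | k < Z ω} (A ∩ {ω | k ≤ Z ω}) (hZ measurableSet_Ioi)
      (hA.inter (hZ measurableSet_Ici))
    have e1 : {ω | k < Z ω + A.indicator 1 ω} = {ω | k < Z ω} ∪ (A ∩ {ω | k ≤ Z ω}) := by
      ext ω
      by_cases hω : ω ∈ A <;> simp [hω]
      omega
    have e2 : A ∩ {ω | k + 1 ≤ Z ω} = {ω | k < Z ω} ∩ (A ∩ {ω | k ≤ Z ω}) := by
      ext ω
      by_cases hω : ω ∈ A <;> simp [hω]
      omega
    rw [e1, e2]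
    linarith
  have h2 := Finset.sum_le_sum fun k (_ : k ∈ Finset.range M) => h k
  rw [Finset.sum_add_distrib, Finset.sum_range_sub' fun k : ℕ => ν (A ∩ {ω | k ≤ Z ω})] at h2
  have h3 := hν.nonneg (A ∩ {ω | M ≤ Z ω})
  simp only [zero_le, ofPred_true, inter_univ] at h2
  linarith

/-- An integer-valued W is the sum of the indicators of {m < W}; they are added to Z one at a time.
-/
lemma SubmodularSets.sum_add_le (hν : IsCapacity ν) (hs : SubmodularSets ν) {Z W : Ω → ℕ}
    (hZ : Measurable Z) (hW : Measurable W) {M : ℕ} (hWM : ∀ ω, W ω ≤ M) :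
    ∑ k ∈ Finset.range M, ν {ω | k < Z ω + W ω} ≤
      ∑ k ∈ Finset.range M, ν {ω | k < Z ω} + ∑ k ∈ Finset.range M, ν {ω | k < W ω} := by
  have key : ∀ m : ℕ, ∑ k ∈ Finset.range M, ν {ω | k < Z ω + min (W ω) m} ≤
      ∑ k ∈ Finset.range M, ν {ω | k < Z ω} + ∑ k ∈ Finset.range m, ν {ω | k < W ω} := by
    intro m
    induction m with
    | zero => simp
    | succ m ih =>
      have h := hs.sum_add_indicator_le hν (hZ.add (hW.min (measurable_const (a := m))))
        (A := {ω | m < W ω}) (hW measurableSet_Ioi) M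
      have e : ∀ k, {ω | k < Z ω + min (W ω) (m + 1)} =
          {ω | k < (Z ω + min (W ω) m) + {ω | m < W ω}.indicator 1 ω} := fun k => by
        ext ω
        by_cases hω : m < W ω
        · simp [hω, min_eq_right hω.le, add_assoc]
        · simp [hω, min_eq_left (not_lt.1 hω), min_eq_left ((not_lt.1 hω).trans (Nat.le_succ m))]
      simp only [e]
      rw [Finset.sum_range_succ]
      simp only [Pi.add_apply] at h
      linarith
  simpa [min_eq_left (hWM _)] using key M

/-- Rounding X and Y up to integers reduces to the integer-valued case, and each rounding costs at
most 1. -/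
lemma SubmodularSets.choquetIntegral_add_le_add_two (hν : IsCapacity ν) (hs : SubmodularSets ν)
    (hX : Measurable X) (hY : Measurable Y) {N : ℕ} (hXN : ∀ ω, X ω ∈ Icc 0 (N : ℝ))
    (hYN : ∀ ω, Y ω ∈ Icc 0 (N : ℝ)) :
    choquetIntegral ν (fun ω => X ω + Y ω) ≤ choquetIntegral ν X + choquetIntegral ν Y + 2 := by
  have hXM : ∀ ω, X ω ∈ Icc 0 ((2 * N : ℕ) : ℝ) := fun ω => ⟨(hXN ω).1, by
    push_cast; linarith [(hXN ω).1, (hXN ω).2]⟩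
  have hYM : ∀ ω, Y ω ∈ Icc 0 ((2 * N : ℕ) : ℝ) := fun ω => ⟨(hYN ω).1, by
    push_cast; linarith [(hYN ω).1, (hYN ω).2]⟩
  have h1 := hν.choquetIntegral_le_sum (X := fun ω => X ω + Y ω) (N := 2 * N) fun ω =>
    ⟨add_nonneg (hXN ω).1 (hYN ω).1, by push_cast; linarith [(hXN ω).2, (hYN ω).2]⟩
  have h2 : ∑ k ∈ Finset.range (2 * N), ν {ω | (k : ℝ) < X ω + Y ω} ≤
      ∑ k ∈ Finset.range (2 * N), ν {ω | k < ⌈X ω⌉₊ + ⌈Y ω⌉₊} :=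
    Finset.sum_le_sum fun k _ => hν.mono fun ω hω => by
      have h3 : (k : ℝ) < X ω + Y ω := hω
      have h4 := Nat.le_ceil (X ω)
      have h5 := Nat.le_ceil (Y ω)
      have : (k : ℝ) < ((⌈X ω⌉₊ + ⌈Y ω⌉₊ : ℕ) : ℝ) := by push_cast; linarith
      exact_mod_cast this
  have h3 := hs.sum_add_le hν (Z := fun ω => ⌈X ω⌉₊) (W := fun ω => ⌈Y ω⌉₊)
    (Nat.measurable_ceil.comp hX) (Nat.measurable_ceil.comp hY) (M := 2 * N)
    fun ω => Nat.ceil_le.2 (hYM ω).2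
  simp only [Nat.lt_ceil] at h3
  have h4 := hν.sum_le_sum_succ_add_one X (2 * N)
  have h5 := hν.sum_le_sum_succ_add_one Y (2 * N)
  have h6 := hν.sum_le_choquetIntegral hXM
  have h7 := hν.sum_le_choquetIntegral hYM
  linarith

lemma le_of_forall_nat_mul_le {a b C : ℝ} (h : ∀ n : ℕ, 0 < n → n * a ≤ n * b + C) : a ≤ b := by
  by_contra! hlt
  obtain ⟨n, hn⟩ := exists_nat_gt (|C| / (a - b))
  rw [div_lt_iff₀ (sub_pos.2 hlt)] at hn
  have hn0 : 0 < n := Nat.pos_of_ne_zero fun h0 => by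
    rw [h0, Nat.cast_zero, zero_mul] at hn
    exact hn.not_ge (abs_nonneg C)
  nlinarith [h n hn0, le_abs_self C]

/-- Shift both variables to be nonnegative and scale by n: the integrals scale with n while the
rounding error stays 2. -/
theorem SubmodularSets.choquetIntegral_add_le (hν : IsCapacity ν) (hs : SubmodularSets ν)
    (hX : X ∈ Linfty Ω) (hY : Y ∈ Linfty Ω) :
    choquetIntegral ν (fun ω => X ω + Y ω) ≤ choquetIntegral ν X + choquetIntegral ν Y := by
  obtain ⟨hXm, C, hC⟩ := hX
  obtain ⟨hYm, D, hD⟩ := hY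
  set K := |C| + |D| with hK
  have hC' : ∀ ω, |X ω| ≤ K := fun ω =>
    (hC ω).trans ((le_abs_self C).trans (le_add_of_nonneg_right (abs_nonneg D)))
  have hD' : ∀ ω, |Y ω| ≤ K := fun ω =>
    (hD ω).trans ((le_abs_self D).trans (le_add_of_nonneg_left (abs_nonneg C)))
  have hXK := fun ω => abs_le.1 (hC' ω)
  have hYK := fun ω => abs_le.1 (hD' ω)
  have hXY : ∃ M, ∀ ω, |X ω + Y ω| ≤ M := ⟨K + K, fun ω => abs_le.2
    ⟨by linarith [(hXK ω).1, (hYK ω).1], by linarith [(hXK ω).2, (hYK ω).2]⟩⟩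
  have hsh : ∀ {Z : Ω → ℝ}, (∃ M, ∀ ω, |Z ω| ≤ M) → ∀ a, ∃ M, ∀ ω, |Z ω + a| ≤ M :=
    fun ⟨M, hM⟩ a => ⟨M + |a|, fun ω => (abs_add_le _ _).trans (by linarith [hM ω])⟩
  refine le_of_forall_nat_mul_le (C := 2) fun n hn => ?_
  have hn' : (0 : ℝ) < n := by exact_mod_cast hn
  obtain ⟨N, hN⟩ := exists_nat_ge (n * (2 * K))
  have h := hs.choquetIntegral_add_le_add_two hν (X := fun ω => n * (X ω + K))
    (Y := fun ω => n * (Y ω + K)) ((hXm.add_const K).const_mul _) ((hYm.add_const K).const_mul _)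
    (N := N)
    (fun ω => ⟨mul_nonneg hn'.le (by linarith [(hXK ω).1]), le_trans
      (mul_le_mul_of_nonneg_left (by linarith [(hXK ω).2]) hn'.le) hN⟩)
    (fun ω => ⟨mul_nonneg hn'.le (by linarith [(hYK ω).1]), le_trans
      (mul_le_mul_of_nonneg_left (by linarith [(hYK ω).2]) hn'.le) hN⟩)
  have e : (fun ω => n * (X ω + K) + n * (Y ω + K)) = fun ω => (n : ℝ) * ((X ω + Y ω) + 2 * K) := by
    ext ω; ring
  rw [e, hν.choquetIntegral_const_mul (hsh ⟨K, hC'⟩ _) hn',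
    hν.choquetIntegral_const_mul (hsh ⟨K, hD'⟩ _) hn',
    hν.choquetIntegral_const_mul (hsh hXY _) hn',
    hν.choquetIntegral_add_const ⟨K, hC'⟩, hν.choquetIntegral_add_const ⟨K, hD'⟩,
    hν.choquetIntegral_add_const hXY] at h
  linarith

end Subadditive

end ScenarioRisk

/-! ### Coherence, quasi-convexity and decreasing increments -/

namespace ScenarioRisk

section Linfty

variable {Ω : Type*} [MeasurableSpace Ω] {X Y : Ω → ℝ}

lemma Linfty.add (hX : X ∈ Linfty Ω) (hY : Y ∈ Linfty Ω) : (fun ω => X ω + Y ω) ∈ Linfty Ω := by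
  obtain ⟨hXm, C, hC⟩ := hX
  obtain ⟨hYm, D, hD⟩ := hY
  exact ⟨hXm.add hYm, C + D, fun ω => (abs_add_le _ _).trans (add_le_add (hC ω) (hD ω))⟩

lemma Linfty.const_mul (hX : X ∈ Linfty Ω) (t : ℝ) : (fun ω => t * X ω) ∈ Linfty Ω := by
  obtain ⟨hXm, C, hC⟩ := hX
  exact ⟨hXm.const_mul t, |t| * C, fun ω => by
    rw [abs_mul]; exact mul_le_mul_of_nonneg_left (hC ω) (abs_nonneg t)⟩

lemma Linfty.const (a : ℝ) : (fun _ => a) ∈ Linfty Ω := ⟨measurable_const, |a|, fun _ => le_rfl⟩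

lemma Linfty.add_const (hX : X ∈ Linfty Ω) (a : ℝ) : (fun ω => X ω + a) ∈ Linfty Ω :=
  Linfty.add hX (Linfty.const a)

lemma Linfty.indicator {A : Set Ω} (hA : MeasurableSet A) : A.indicator (1 : Ω → ℝ) ∈ Linfty Ω :=
  ⟨measurable_one.indicator hA, 1, fun ω => by by_cases h : ω ∈ A <;> simp [h]⟩

lemma LOne.mem_Linfty (hX : X ∈ LOne Ω) : X ∈ Linfty Ω :=
  ⟨hX.1, 1, fun ω => abs_le.2 ⟨by linarith [(hX.2 ω).1], (hX.2 ω).2⟩⟩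

end Linfty

section Distortion

variable {Ω : Type*} [MeasurableSpace Ω] {P : Measure Ω} [IsProbabilityMeasure P] {s : ℕ}
  {S : Fin s → Set Ω} {g : (Fin s → ℝ) → ℝ} {ρ : (Ω → ℝ) → ℝ} {X Y : Ω → ℝ}

lemma IsScenarios.scenarioProb_mem (hS : IsScenarios P S) (A : Set Ω) :
    scenarioProb P S A ∈ Icc (0 : Fin s → ℝ) 1 :=
  ⟨fun _ => measureReal_nonneg, fun j => by
    have := hS.isProbabilityMeasure_cond j
    exact measureReal_le_one⟩

lemma IsScenarios.scenarioProb_mono (hS : IsScenarios P S) : Monotone (scenarioProb P S) :=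
  fun A B h j => by
    have := hS.isProbabilityMeasure_cond j
    exact measureReal_mono h

lemma IsScenarios.scenarioProb_union (hS : IsScenarios P S) {A B : Set Ω} (h : Disjoint A B)
    (hB : MeasurableSet B) :
    scenarioProb P S (A ∪ B) = scenarioProb P S A + scenarioProb P S B := by
  ext j
  have := hS.isProbabilityMeasure_cond j
  exact measureReal_union h hB

lemma IsScenarios.isCapacity (hS : IsScenarios P S) (hg : IsDistortionFunction g) :
    IsCapacity fun A => g (scenarioProb P S A) where
  mono A B h := hg.mono (hS.scenarioProb_mem A) (hS.scenarioProb_mem B) (hS.scenarioProb_mono h)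
  map_empty := by
    rw [show scenarioProb P S ∅ = 0 from funext fun j => by simp [scenarioProb], hg.map_zero]
  map_univ := by
    rw [show scenarioProb P S univ = 1 from funext fun j => ?_, hg.map_one]
    have := hS.isProbabilityMeasure_cond j
    simp [scenarioProb]

/-- The four-point inequality with base P^S(A ∩ B) and increments P^S(A \ B) and P^S(B \ A). -/
lemma DecreasingIncrements.submodularSets (hS : IsScenarios P S) (hd : DecreasingIncrements g) :
    SubmodularSets fun A => g (scenarioProb P S A) := by
  intro A B hA hB
  have eA : scenarioProb P S (A ∩ B) + scenarioProb P S (A \ B) = scenarioProb P S A := by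
    rw [← hS.scenarioProb_union disjoint_sdiff_inter.symm (hA.diff hB), inter_union_sdiff]
  have eB : scenarioProb P S (A ∩ B) + scenarioProb P S (B \ A) = scenarioProb P S B := by
    rw [inter_comm, ← hS.scenarioProb_union disjoint_sdiff_inter.symm (hB.diff hA),
      inter_union_sdiff]
  have eU : scenarioProb P S A + scenarioProb P S (B \ A) = scenarioProb P S (A ∪ B) := by
    rw [← hS.scenarioProb_union disjoint_sdiff_right (hB.diff hA), union_sdiff_self]
  have := hd _ _ _ (hS.scenarioProb_mem (A ∩ B)).1 (hS.scenarioProb_mem (A \ B)).1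
    (hS.scenarioProb_mem (B \ A)).1
  rw [eA, eB, eU] at this
  exact this (hS.scenarioProb_mem _).2

namespace IsDistortionRiskMeasure

lemma apply_indicator (hS : IsScenarios P S) (hρ : IsDistortionRiskMeasure P S g ρ) {A : Set Ω}
    (hA : MeasurableSet A) : ρ (A.indicator 1) = g (scenarioProb P S A) := by
  rw [hρ.eq_choquet _ (Linfty.indicator hA)]
  exact (hS.isCapacity hρ.distortion).choquetIntegral_indicator A

lemma apply_indicator_add (hS : IsScenarios P S) (hρ : IsDistortionRiskMeasure P S g ρ)
    {A B : Set Ω} (hA : MeasurableSet A) (hB : MeasurableSet B) :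
    ρ (fun ω => A.indicator 1 ω + B.indicator 1 ω) =
      g (scenarioProb P S (A ∪ B)) + g (scenarioProb P S (A ∩ B)) := by
  rw [hρ.eq_choquet _ (Linfty.add (Linfty.indicator hA) (Linfty.indicator hB))]
  exact (hS.isCapacity hρ.distortion).choquetIntegral_indicator_add A B

lemma add_const (hS : IsScenarios P S) (hρ : IsDistortionRiskMeasure P S g ρ)
    (hX : X ∈ Linfty Ω) (a : ℝ) : ρ (fun ω => X ω + a) = ρ X + a := by
  rw [hρ.eq_choquet _ hX, hρ.eq_choquet _ (Linfty.add_const hX a)]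
  exact (hS.isCapacity hρ.distortion).choquetIntegral_add_const hX.2 a

lemma const_mul (hS : IsScenarios P S) (hρ : IsDistortionRiskMeasure P S g ρ)
    (hX : X ∈ Linfty Ω) {t : ℝ} (ht : 0 < t) : ρ (fun ω => t * X ω) = t * ρ X := by
  rw [hρ.eq_choquet _ hX, hρ.eq_choquet _ (Linfty.const_mul hX t)]
  exact (hS.isCapacity hρ.distortion).choquetIntegral_const_mul hX.2 ht

lemma mono_ae (hS : IsScenarios P S) (hρ : IsDistortionRiskMeasure P S g ρ)
    (hX : X ∈ Linfty Ω) (hY : Y ∈ Linfty Ω) (h : ∀ᵐ ω ∂P, X ω ≤ Y ω) : ρ X ≤ ρ Y := by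
  rw [hρ.eq_choquet _ hX, hρ.eq_choquet _ hY]
  refine (hS.isCapacity hρ.distortion).choquetIntegral_mono hX.2 hY.2 fun x =>
    hρ.distortion.mono (hS.scenarioProb_mem _) (hS.scenarioProb_mem _) fun j => ?_
  have := hS.isProbabilityMeasure_cond j
  refine ENNReal.toReal_mono (measure_ne_top _ _) (measure_mono_ae ?_)
  filter_upwards [(ae_iff_forall_ae_cond hS).1 h j] with ω hω h'
  exact lt_of_lt_of_le h' hω

theorem isCoherent (hS : IsScenarios P S) (hρ : IsDistortionRiskMeasure P S g ρ)
    (hd : DecreasingIncrements g) : IsCoherent P ρ where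
  mono X hX Y hY h := hρ.mono_ae hS hX hY h
  translation X hX a := hρ.add_const hS hX a
  homogeneous X hX t ht := hρ.const_mul hS hX ht
  convex X hX Y hY t ht := by
    rcases ht.1.eq_or_lt with rfl | h0
    · simp
    rcases ht.2.eq_or_lt with rfl | h1
    · simp
    have h := (hd.submodularSets hS).choquetIntegral_add_le (hS.isCapacity hρ.distortion)
      (Linfty.const_mul hX t) (Linfty.const_mul hY (1 - t))
    rw [← hρ.const_mul hS hX h0, ← hρ.const_mul hS hY (sub_pos.2 h1),
      hρ.eq_choquet _ (Linfty.const_mul hX t), hρ.eq_choquet _ (Linfty.const_mul hY (1 - t)),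
      hρ.eq_choquet _ (Linfty.add (Linfty.const_mul hX t) (Linfty.const_mul hY (1 - t)))]
    exact h

omit [IsProbabilityMeasure P] in
lemma _root_.ScenarioRisk.IsCoherent.quasiConvex (h : IsCoherent P ρ) : QuasiConvex ρ := by
  intro X hX Y hY t ht
  refine (h.convex X hX Y hY t ht).trans ?_
  have h1 := mul_le_mul_of_nonneg_left (le_max_left (ρ X) (ρ Y)) ht.1
  have h2 := mul_le_mul_of_nonneg_left (le_max_right (ρ X) (ρ Y)) (sub_nonneg.2 ht.2)
  linarith

/-- Quasi-convexity, translation invariance and homogeneity imply subadditivity. -/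
lemma add_le_of_quasiConvex (hS : IsScenarios P S) (hρ : IsDistortionRiskMeasure P S g ρ)
    (hq : QuasiConvex ρ) (hX : X ∈ Linfty Ω) (hY : Y ∈ Linfty Ω) :
    ρ (fun ω => X ω + Y ω) ≤ ρ X + ρ Y := by
  -- After the shift both risks are 0, so the maximum is 0 and the midpoint bound becomes additive.
  have h := hq _ (Linfty.add_const hX (-ρ X)) _ (Linfty.add_const hY (-ρ Y)) (1 / 2)
    ⟨by norm_num, by norm_num⟩
  rw [hρ.add_const hS hX, hρ.add_const hS hY, add_neg_cancel, add_neg_cancel, max_self] at h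
  have e : (fun ω => 1 / 2 * (X ω + -ρ X) + (1 - 1 / 2) * (Y ω + -ρ Y)) =
      fun ω => 1 / 2 * ((X ω + Y ω) + (-ρ X - ρ Y)) := by
    ext ω; ring
  rw [e, hρ.const_mul hS (Linfty.add_const (Linfty.add hX hY) _) (by norm_num),
    hρ.add_const hS (Linfty.add hX hY)] at h
  linarith

/-- Subadditivity is tested on the indicators of E (u + h) and E u ∪ D, where D has probability
vector k and is disjoint from E (u + h): their intersection has vector u and their union u + h + k.
-/
theorem decreasingIncrements (hP : Atomless P) (hS : IsScenarios P S)
    (hρ : IsDistortionRiskMeasure P S g ρ) (hq : QuasiConvex ρ) : DecreasingIncrements g := by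
  intro u h k hu hh hk h1
  obtain ⟨E, hE, hEm, hEp, -⟩ := hS.exists_events hP
  have hu1 : u + h ≤ 1 := (le_add_of_nonneg_right hk).trans h1
  have hu2 : u ≤ 1 := (le_add_of_nonneg_right hh).trans hu1
  have pu := hEp u ⟨hu, hu2⟩
  have puh := hEp (u + h) ⟨add_nonneg hu hh, hu1⟩
  have puhk := hEp (u + h + k) ⟨add_nonneg (add_nonneg hu hh) hk, h1⟩
  have s1 : E u ⊆ E (u + h) := hEm (le_add_of_nonneg_right hh)
  have s2 : E (u + h) ⊆ E (u + h + k) := hEm (le_add_of_nonneg_right hk)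
  set D := E (u + h + k) \ E (u + h) with hD
  have hDm : MeasurableSet D := (hE _).diff (hE _)
  have pD : scenarioProb P S D = k := by
    have := hS.scenarioProb_union (disjoint_sdiff_right (s := E (u + h)) (t := E (u + h + k))) hDm
    rw [union_sdiff_cancel s2, puhk, puh] at this
    exact (add_left_cancel this).symm
  have pB : scenarioProb P S (E u ∪ D) = u + k := by
    rw [hS.scenarioProb_union (disjoint_sdiff_right.mono_left s1) hDm, pu, pD]
  have eU : E (u + h) ∪ (E u ∪ D) = E (u + h + k) := by
    rw [← union_assoc, union_eq_left.2 s1, hD, union_sdiff_cancel s2]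
  have eI : E (u + h) ∩ (E u ∪ D) = E u := by
    rw [inter_union_distrib_left, inter_eq_right.2 s1, hD, inter_sdiff_self, union_empty]
  have := hρ.add_le_of_quasiConvex hS hq (Linfty.indicator (hE (u + h)))
    (Linfty.indicator ((hE u).union hDm))
  rwa [hρ.apply_indicator_add hS (hE _) ((hE u).union hDm), hρ.apply_indicator hS (hE _),
    hρ.apply_indicator hS ((hE u).union hDm), eU, eI, pu, puh, puhk, pB] at this

end IsDistortionRiskMeasure

end Distortion

end ScenarioRisk

/-! ### The Lebesgue property and continuity of g -/

namespace ScenarioRisk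

namespace IsDistortionRiskMeasure

variable {Ω : Type*} [MeasurableSpace Ω] {P : Measure Ω} [IsProbabilityMeasure P] {s : ℕ}
  {S : Fin s → Set Ω} {g : (Fin s → ℝ) → ℝ} {ρ : (Ω → ℝ) → ℝ}

/-- If a n → b in the cube, the indicators of the events E (a n) converge almost surely, and their
risks are the values g (a n). -/
theorem continuousOn (hP : Atomless P) (hS : IsScenarios P S)
    (hρ : IsDistortionRiskMeasure P S g ρ) (hl : LebesgueContinuous P ρ) :
    ContinuousOn g (Icc (0 : Fin s → ℝ) 1) := by
  obtain ⟨E, hE, -, hEp, hEt⟩ := hS.exists_events hP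
  intro b hb
  refine tendsto_of_seq_tendsto fun a ha => ?_
  obtain ⟨ha1, ha2⟩ := tendsto_nhdsWithin_iff.1 ha
  have h := hl (fun n => (E (a n)).indicator 1) ((E b).indicator 1)
    (fun n => measurable_one.indicator (hE _))
    ⟨1, fun n ω => by by_cases h : ω ∈ E (a n) <;> simp [h]⟩ (Linfty.indicator (hE b)) (by
      filter_upwards [hEt a b ha1] with ω hω
      refine tendsto_const_nhds.congr' ?_
      filter_upwards [hω] with n hn
      by_cases h : ω ∈ E b
      · simp [h, hn.2 h]
      · simp [h, mt hn.1 h])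
  rw [hρ.apply_indicator hS (hE b), hEp b hb] at h
  refine h.congr' ?_
  filter_upwards [ha2] with n hn
  rw [hρ.apply_indicator hS (hE _), hEp _ hn]
  rfl

theorem lebesgueContinuous (hS : IsScenarios P S)
    (hρ : IsDistortionRiskMeasure P S g ρ) (hg : ContinuousOn g (Icc (0 : Fin s → ℝ) 1)) :
    LebesgueContinuous P ρ := by
  rintro X Y hX ⟨C, hC⟩ hY hlim
  obtain ⟨hYm, D, hD⟩ := hY
  have hν := hS.isCapacity (S := S) hρ.distortion
  have h1 : ∀ l ω, |X l ω| ≤ max C D := fun l ω => (hC l ω).trans (le_max_left _ _)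
  have h2 : ∀ ω, |Y ω| ≤ max C D := fun ω => (hD ω).trans (le_max_right _ _)
  have h3 := fun l => exists_bounds_of_abs_le (h1 l)
  have h4 := exists_bounds_of_abs_le h2
  rw [hρ.eq_choquet Y ⟨hYm, D, hD⟩, hν.choquetIntegral_eq h4.1.1 h4.1.2 h4.2]
  simp_rw [fun l => hρ.eq_choquet (X l) ⟨hX l, C, hC l⟩,
    fun l => hν.choquetIntegral_eq h4.1.1 h4.1.2 (h3 l).2]
  refine Tendsto.add_const _ (intervalIntegral.tendsto_integral_filter_of_dominated_convergence
    (fun _ => 1) (.of_forall fun l => ?_) (.of_forall fun l => .of_forall fun x _ => ?_)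
    intervalIntegrable_const ?_)
  · exact (hν.antitone (X l)).measurable.aestronglyMeasurable
  · rw [Real.norm_eq_abs, abs_of_nonneg (hν.nonneg _)]
    exact hν.le_one _
  -- Only countably many levels carry an atom of Y. At any other level x the events {X l > x}
  -- converge almost surely to {Y > x}, so the arguments of g converge within the cube.
  · have hae : ∀ᵐ x : ℝ, P {ω | Y ω = x} = 0 := by
      have hc : {x : ℝ | 0 < P {ω | Y ω = x}}.Countable :=
        Measure.countable_meas_level_set_pos hYm
      filter_upwards [hc.ae_notMem volume] with x hx
      simpa using hx
    filter_upwards [hae] with x hx _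
    have hx' : ∀ᵐ ω ∂P, Y ω ≠ x := by rw [ae_iff]; simpa using hx
    have hev : ∀ᵐ ω ∂P, ∀ᶠ l in atTop, ω ∈ {ω | x < X l ω} ↔ ω ∈ {ω | x < Y ω} := by
      filter_upwards [hlim, hx'] with ω hω hne
      rcases lt_or_gt_of_ne hne with h | h
      · filter_upwards [hω.eventually (gt_mem_nhds h)] with l hl
        exact ⟨fun h' => absurd h' hl.not_gt, fun h' => absurd h' h.not_gt⟩
      · filter_upwards [hω.eventually (lt_mem_nhds h)] with l hl
        exact ⟨fun _ => h, fun _ => hl⟩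
    refine (hg _ (hS.scenarioProb_mem {ω | x < Y ω})).tendsto.comp
      (tendsto_nhdsWithin_iff.2 ⟨tendsto_pi_nhds.2 fun j => ?_,
        .of_forall fun l => hS.scenarioProb_mem _⟩)
    have := hS.isProbabilityMeasure_cond j
    exact (ENNReal.tendsto_toReal (measure_ne_top _ _)).comp
      (tendsto_measure_of_ae_tendsto_indicator_of_isFiniteMeasure atTop
        (hYm measurableSet_Ioi) (fun l => hX l measurableSet_Ioi)
        ((ae_iff_forall_ae_cond hS).1 hev j))

end IsDistortionRiskMeasure

end ScenarioRisk

/-! ### Layers, stop-loss premia and risk aversion -/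

namespace ScenarioRisk

section Layer

variable {Ω : Type*} [MeasurableSpace Ω]

/-- The expected loss `E[min((Z - k)₊, 1)]` of the layer `[k, k + 1]`. -/
noncomputable def layer (Q : Measure Ω) (Z : Ω → ℝ) (k : ℕ) : ℝ :=
  ∫ ω, (max (Z ω - k) 0 - max (Z ω - (k + 1 : ℕ)) 0) ∂Q

variable {Q : Measure Ω} [IsProbabilityMeasure Q] {Z : Ω → ℝ} {N : ℕ}

lemma integrable_max_sub (hZ : Measurable Z) (hZN : ∀ ω, Z ω ∈ Icc 0 (N : ℝ)) (k : ℕ) :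
    Integrable (fun ω => max (Z ω - k) 0) Q := by
  refine Integrable.of_bound ((hZ.sub_const _).max measurable_const).aestronglyMeasurable (N : ℝ)
    (.of_forall fun ω => ?_)
  rw [Real.norm_eq_abs, abs_of_nonneg (le_max_right _ _)]
  exact max_le (by linarith [(hZN ω).2, (Nat.cast_nonneg k : (0 : ℝ) ≤ k)]) (Nat.cast_nonneg N)

lemma layer_le (hZ : Measurable Z) (hZN : ∀ ω, Z ω ∈ Icc 0 (N : ℝ)) (k : ℕ) :
    layer Q Z k ≤ Q.real {ω | (k : ℝ) < Z ω} := by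
  rw [← integral_indicator_one (measurableSet_lt measurable_const hZ)]
  refine integral_mono ((integrable_max_sub hZ hZN k).sub (integrable_max_sub hZ hZN (k + 1)))
    ((integrable_const (1 : ℝ)).indicator (hZ measurableSet_Ioi)) fun ω => ?_
  dsimp only
  push_cast
  by_cases h : (k : ℝ) < Z ω
  · rw [indicator_of_mem (show ω ∈ {ω | (k : ℝ) < Z ω} from h), max_eq_left (by linarith)]
    have := le_max_left (Z ω - (k + 1)) 0
    simp only [Pi.one_apply]
    linarith
  · rw [indicator_of_notMem (show ω ∉ {ω | (k : ℝ) < Z ω} from h), max_eq_right (by linarith),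
      max_eq_right (by linarith)]
    simp

lemma le_layer (hZ : Measurable Z) (hZN : ∀ ω, Z ω ∈ Icc 0 (N : ℝ)) (k : ℕ) :
    Q.real {ω | ((k + 1 : ℕ) : ℝ) < Z ω} ≤ layer Q Z k := by
  rw [← integral_indicator_one (measurableSet_lt measurable_const hZ)]
  refine integral_mono ((integrable_const (1 : ℝ)).indicator (hZ measurableSet_Ioi))
    ((integrable_max_sub hZ hZN k).sub (integrable_max_sub hZ hZN (k + 1))) fun ω => ?_
  dsimp only
  by_cases h : ((k + 1 : ℕ) : ℝ) < Z ω
  · rw [indicator_of_mem (show ω ∈ {ω | ((k + 1 : ℕ) : ℝ) < Z ω} from h)]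
    push_cast at h ⊢
    rw [max_eq_left (by linarith), max_eq_left (by linarith)]
    simp
  · rw [indicator_of_notMem (show ω ∉ {ω | ((k + 1 : ℕ) : ℝ) < Z ω} from h)]
    push_cast
    exact sub_nonneg.2 (max_le_max_right _ (by linarith))

/-- The survival probability at level k + 1 separates the layers k and k + 1. -/
lemma layer_antitone (hZ : Measurable Z) (hZN : ∀ ω, Z ω ∈ Icc 0 (N : ℝ)) :
    Antitone (layer Q Z) :=
  antitone_nat_of_succ_le fun k => (layer_le hZ hZN (k + 1)).trans (le_layer hZ hZN k)

/-- The layers telescope, and the premium at the top level N vanishes. This turns the stop-loss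
order into an order of tail sums. -/
lemma sum_layer (hZ : Measurable Z) (hZN : ∀ ω, Z ω ∈ Icc 0 (N : ℝ)) {m : ℕ} (hm : m ≤ N) :
    ∑ k ∈ Finset.Ico m N, layer Q Z k = ∫ ω, max (Z ω - m) 0 ∂Q := by
  have h : ∀ k, layer Q Z k = -((∫ ω, max (Z ω - (k + 1 : ℕ)) 0 ∂Q) - ∫ ω, max (Z ω - k) 0 ∂Q) :=
    fun k => by
      rw [layer, integral_sub (integrable_max_sub hZ hZN k) (integrable_max_sub hZ hZN (k + 1))]
      ring
  simp_rw [h]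
  rw [Finset.sum_neg_distrib, Finset.sum_Ico_sub (fun k : ℕ => ∫ ω, max (Z ω - k) 0 ∂Q) hm]
  have h0 : ∀ ω, max (Z ω - N) 0 = 0 := fun ω => max_eq_right (by linarith [(hZN ω).2])
  simp [h0]

end Layer

variable {Ω : Type*} [MeasurableSpace Ω] {P : Measure Ω} [IsProbabilityMeasure P] {s : ℕ}
  {S : Fin s → Set Ω} {g : (Fin s → ℝ) → ℝ} {ρ : (Ω → ℝ) → ℝ}

/-- For losses in `[0, N]` with ordered stop-loss premia, the comparison holds up to an additive
constant. -/
lemma DecreasingIncrements.choquetIntegral_le_add_two (hS : IsScenarios P S)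
    (hg : IsDistortionFunction g) (hd : DecreasingIncrements g) {X Y : Ω → ℝ} (hX : Measurable X)
    (hY : Measurable Y) {N : ℕ} (hXN : ∀ ω, X ω ∈ Icc 0 (N : ℝ)) (hYN : ∀ ω, Y ω ∈ Icc 0 (N : ℝ))
    (h : ∀ j, ∀ k : ℕ, ∫ ω, max (X ω - k) 0 ∂(P[|S j]) ≤ ∫ ω, max (Y ω - k) 0 ∂(P[|S j])) :
    choquetIntegral (fun A => g (scenarioProb P S A)) X ≤
      choquetIntegral (fun A => g (scenarioProb P S A)) Y + 2 := by
  have := hS.isProbabilityMeasure_cond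
  have hν := hS.isCapacity hg
  have hmem : ∀ {Z : Ω → ℝ}, Measurable Z → (∀ ω, Z ω ∈ Icc 0 (N : ℝ)) → ∀ k,
      (fun j => layer (P[|S j]) Z k) ∈ Icc (0 : Fin s → ℝ) 1 := fun hZ hZN k =>
    ⟨fun j => measureReal_nonneg.trans (le_layer hZ hZN k),
      fun j => (layer_le hZ hZN k).trans measureReal_le_one⟩
  have h1 := hν.choquetIntegral_le_sum hXN
  have h2 := hν.sum_le_sum_succ_add_one X N
  -- Layer vectors lie between consecutive survival vectors. The resulting shift of one level costs
  -- at most 1 for X and at most 1 for Y.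
  have h3 : ∑ k ∈ Finset.range N, g (scenarioProb P S {ω | ((k + 1 : ℕ) : ℝ) < X ω}) ≤
      ∑ k ∈ Finset.range N, g fun j => layer (P[|S j]) X k :=
    Finset.sum_le_sum fun k _ => hg.mono (hS.scenarioProb_mem _) (hmem hX hXN k)
      fun j => le_layer hX hXN k
  have h4 := hd.sum_le_sum hg.mono (N := N) (hmem hX hXN) (hmem hY hYN)
    (fun k l hkl j => layer_antitone hX hXN hkl) (fun k l hkl j => layer_antitone hY hYN hkl)
    fun j m hm => by
      rw [sum_layer hX hXN hm, sum_layer hY hYN hm]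
      exact h j m
  have h5 : ∑ k ∈ Finset.range N, g (fun j => layer (P[|S j]) Y k) ≤
      ∑ k ∈ Finset.range N, g (scenarioProb P S {ω | (k : ℝ) < Y ω}) :=
    Finset.sum_le_sum fun k _ => hg.mono (hmem hY hYN k) (hS.scenarioProb_mem _)
      fun j => layer_le hY hYN k
  have h6 := hν.sum_le_sum_succ_add_one Y N
  have h7 := hν.sum_le_choquetIntegral hYN
  linarith

theorem IsDistortionRiskMeasure.sRiskAverse (hS : IsScenarios P S)
    (hρ : IsDistortionRiskMeasure P S g ρ) (hd : DecreasingIncrements g) :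
    SRiskAverse P S ρ := by
  intro X hX Y hY hXY
  obtain ⟨hXm, C, hC⟩ := id hX
  obtain ⟨hYm, D, hD⟩ := id hY
  set K := max C D with hK
  have hXK := fun ω => abs_le.1 ((hC ω).trans (le_max_left C D))
  have hYK := fun ω => abs_le.1 ((hD ω).trans (le_max_right C D))
  -- Scaling by n makes the unit layers fine relative to X and Y; the error 2 then disappears in the
  -- limit.
  refine le_of_forall_nat_mul_le (C := 2) fun n hn => ?_
  have hn' : (0 : ℝ) < n := by exact_mod_cast hn
  obtain ⟨N, hN⟩ := exists_nat_ge (n * (2 * K))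
  have h := hd.choquetIntegral_le_add_two hS hρ.distortion (X := fun ω => n * (X ω + K))
    (Y := fun ω => n * (Y ω + K)) ((hXm.add_const K).const_mul _) ((hYm.add_const K).const_mul _)
    (N := N)
    (fun ω => ⟨mul_nonneg hn'.le (by linarith [(hXK ω).1]), le_trans
      (mul_le_mul_of_nonneg_left (by linarith [(hXK ω).2]) hn'.le) hN⟩)
    (fun ω => ⟨mul_nonneg hn'.le (by linarith [(hYK ω).1]), le_trans
      (mul_le_mul_of_nonneg_left (by linarith [(hYK ω).2]) hn'.le) hN⟩)
    (fun j k => hXY (fun x => max (n * (x + K) - k) 0)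
      (fun x y hxy => max_le_max_right _ (by gcongr)) (ConvexOn.sup ⟨convex_univ,
        fun x _ y _ a b _ _ hab => by
          simp only [smul_eq_mul]
          have : b = 1 - a := by linarith
          subst this
          exact le_of_eq (by ring)⟩ (convexOn_const 0 convex_univ)) j)
  rw [← hρ.eq_choquet _ (Linfty.const_mul (Linfty.add_const hX K) n),
    ← hρ.eq_choquet _ (Linfty.const_mul (Linfty.add_const hY K) n),
    hρ.const_mul hS (Linfty.add_const hX K) hn', hρ.const_mul hS (Linfty.add_const hY K) hn',
    hρ.add_const hS hX, hρ.add_const hS hY] at h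
  linarith

end ScenarioRisk

/-! ### Exchangeability and the pooling effect -/

namespace ScenarioRisk

section Pooling

variable {Ω : Type*} [MeasurableSpace Ω] {Q : Measure Ω} [IsProbabilityMeasure Q]
  {L : ℕ → Ω → ℝ}

/-- Conditionally on m, the probability factors and each factor may be computed with L 0. Its
expectation therefore ignores which distinct indices were chosen. -/
lemma CondIID.exists_measure_inter (hL : ∀ i, Measurable (L i)) (h : CondIID Q L) {l : ℕ}
    (B : Fin l → Set ℝ) (hB : ∀ i, MeasurableSet (B i)) :
    ∃ c : ℝ, ∀ e : Fin l → ℕ, Function.Injective e → Q.real (⋂ i, L (e i) ⁻¹' B i) = c := by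
  have hA : ∀ e : Fin l → ℕ, MeasurableSet (⋂ i, L (e i) ⁻¹' B i) := fun e =>
    .iInter fun i => hL _ (hB i)
  obtain ⟨d, Z, hZ, hind, hid⟩ := h
  set m := MeasurableSpace.comap Z inferInstance with hm
  have hle := hZ.comap_le
  refine ⟨∫ ω, (∏ i, Q⟦L 0 ⁻¹' B i | m⟧) ω ∂Q, fun e he => ?_⟩
  rw [← integral_indicator_one (hA e), ← integral_condExp hle]
  refine integral_congr_ae ?_
  -- The family B is moved to the indices e i; elsewhere it takes the value `univ`, which is
  -- measurable and never enters the intersection.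
  have h1 := hind (Finset.univ.map ⟨e, he⟩) (Function.extend e B fun _ => univ) fun k => by
    by_cases hk : ∃ i, e i = k
    · obtain ⟨i, rfl⟩ := hk
      rw [he.extend_apply]
      exact hB i
    · rw [Function.extend_apply' _ _ _ hk]
      exact .univ
  have e1 : ⋂ k ∈ Finset.univ.map ⟨e, he⟩, L k ⁻¹' (Function.extend e B fun _ => univ) k =
      ⋂ i, L (e i) ⁻¹' B i := by
    ext ω
    simp [he.extend_apply]
  rw [e1, Finset.prod_map] at h1
  simp only [Function.Embedding.coeFn_mk, he.extend_apply] at h1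
  refine h1.trans ?_
  have h2 : ∀ᵐ ω ∂Q, ∀ i, (Q⟦L (e i) ⁻¹' B i | m⟧) ω = (Q⟦L 0 ⁻¹' B i | m⟧) ω :=
    ae_all_iff.2 fun i => hid (e i) 0 (B i) (hB i)
  filter_upwards [h2] with ω hω
  simp only [Finset.prod_apply, hω]

/-- Conditionally iid sequences are exchangeable. -/
lemma CondIID.map_eq (hL : ∀ i, Measurable (L i)) (h : CondIID Q L) {l : ℕ} {e e' : Fin l → ℕ}
    (he : Function.Injective e) (he' : Function.Injective e') :
    Q.map (fun ω i => L (e i) ω) = Q.map (fun ω i => L (e' i) ω) := by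
  have hm : ∀ e : Fin l → ℕ, Measurable fun ω i => L (e i) ω := fun e =>
    measurable_pi_lambda _ fun i => hL (e i)
  have : ∀ e : Fin l → ℕ, IsProbabilityMeasure (Q.map fun ω i => L (e i) ω) := fun e =>
    Measure.isProbabilityMeasure_map (hm e).aemeasurable
  refine ext_of_generate_finite _ generateFrom_pi.symm isPiSystem_pi ?_ (by simp)
  rintro _ ⟨B, hB, rfl⟩
  have hB' : ∀ i, MeasurableSet (B i) := fun i => hB i (mem_univ i)
  obtain ⟨c, hc⟩ := h.exists_measure_inter hL B hB'
  have hpre : ∀ e : Fin l → ℕ, (fun ω i => L (e i) ω) ⁻¹' univ.pi B = ⋂ i, L (e i) ⁻¹' B i :=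
    fun e => by ext ω; simp
  rw [Measure.map_apply (hm e) (.univ_pi hB'), Measure.map_apply (hm e') (.univ_pi hB'), hpre, hpre,
    ← ofReal_measureReal (measure_ne_top _ _), ← ofReal_measureReal (measure_ne_top _ _), hc e he,
    hc e' he']

lemma pool_mem_LOne (hL : ∀ i, L i ∈ LOne Ω) (l : ℕ) : pool L l ∈ LOne Ω := by
  refine ⟨(Finset.measurable_sum _ fun i _ => (hL i).1).div_const _, fun ω => ?_⟩
  have h0 : 0 ≤ ∑ i ∈ Finset.range l, L i ω := Finset.sum_nonneg fun i _ => ((hL i).2 ω).1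
  have h1 : ∑ i ∈ Finset.range l, L i ω ≤ l := by
    simpa using Finset.sum_le_sum fun i (_ : i ∈ Finset.range l) => ((hL i).2 ω).2
  exact ⟨div_nonneg h0 (Nat.cast_nonneg l), div_le_one_of_le₀ h1 (Nat.cast_nonneg l)⟩

lemma integrable_monotone_comp {ψ : ℝ → ℝ} (hψ : Monotone ψ) {X : Ω → ℝ} (hX : X ∈ LOne Ω) :
    Integrable (fun ω => ψ (X ω)) Q := by
  refine Integrable.of_bound (hψ.measurable.comp hX.1).aestronglyMeasurable (|ψ 0| + |ψ 1|)
    (.of_forall fun ω => ?_)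
  have h0 := hψ (hX.2 ω).1
  have h1 := hψ (hX.2 ω).2
  rw [Real.norm_eq_abs, abs_le]
  constructor <;>
    linarith [neg_abs_le (ψ 0), neg_abs_le (ψ 1), le_abs_self (ψ 0), le_abs_self (ψ 1)]

/-- The average over `l + 1` terms is the mean of the leave-one-out averages. -/
lemma sum_div_eq_sum_succAbove {l : ℕ} (hl : 0 < l) (x : ℕ → ℝ) :
    (∑ k ∈ Finset.range (l + 1), x k) / (l + 1 : ℕ) =
      ∑ i : Fin (l + 1), (1 / ((l : ℝ) + 1)) • ((∑ k : Fin l, x (i.succAbove k)) / l) := by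
  have h : ∀ i : Fin (l + 1), ∑ k : Fin l, x (i.succAbove k) = (∑ k : Fin (l + 1), x k) - x i :=
    fun i => by rw [Fin.sum_univ_succAbove (fun k : Fin (l + 1) => x k) i]; ring
  have hl' : (0 : ℝ) < l := by exact_mod_cast hl
  simp_rw [h]
  rw [← Finset.smul_sum, ← Finset.sum_div, Finset.sum_sub_distrib, Finset.sum_range]
  simp only [Finset.sum_const, Finset.card_univ, Fintype.card_fin, nsmul_eq_mul, smul_eq_mul]
  push_cast
  field_simp
  ring

/-- Jensen's inequality for the leave-one-out averages, each of which has the law of `pool L l` by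
exchangeability. -/
lemma CondIID.integral_pool_succ_le (hL : ∀ i, L i ∈ LOne Ω) (h : CondIID Q L) {l : ℕ}
    (hl : 0 < l) {ψ : ℝ → ℝ} (hm : Monotone ψ) (hc : ConvexOn ℝ univ ψ) :
    ∫ ω, ψ (pool L (l + 1) ω) ∂Q ≤ ∫ ω, ψ (pool L l ω) ∂Q := by
  have hLm := fun i => (hL i).1
  have hl' : (0 : ℝ) < l := by exact_mod_cast hl
  set A : Fin (l + 1) → Ω → ℝ := fun i ω => (∑ k : Fin l, L (i.succAbove k) ω) / l with hA
  have hAL : ∀ i, A i ∈ LOne Ω := fun i => by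
    refine ⟨(Finset.measurable_sum _ fun k _ => hLm _).div_const _, fun ω => ?_⟩
    have h0 : 0 ≤ ∑ k : Fin l, L (i.succAbove k) ω := Finset.sum_nonneg fun k _ => ((hL _).2 ω).1
    have h1 : ∑ k : Fin l, L (i.succAbove k) ω ≤ l := by
      simpa using Finset.sum_le_sum fun k (_ : k ∈ Finset.univ) =>
        ((hL (i.succAbove k : Fin (l + 1))).2 ω).2
    exact ⟨div_nonneg h0 hl'.le, div_le_one_of_le₀ h1 hl'.le⟩
  have hlaw : ∀ i, ∫ ω, ψ (A i ω) ∂Q = ∫ ω, ψ (pool L l ω) ∂Q := fun i => by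
    have hf : Measurable fun x : Fin l → ℝ => ψ ((∑ k, x k) / l) :=
      hm.measurable.comp ((Finset.measurable_sum _ fun k _ => measurable_pi_apply k).div_const _)
    have hmap := h.map_eq hLm (e := fun k : Fin l => (i.succAbove k : ℕ)) (e' := fun k => (k : ℕ))
      (Fin.val_injective.comp Fin.succAbove_right_injective) Fin.val_injective
    have h1 := integral_map (μ := Q) (φ := fun ω (k : Fin l) => L (i.succAbove k) ω)
      (measurable_pi_lambda _ fun k => hLm _).aemeasurable hf.aestronglyMeasurable
    have h2 := integral_map (μ := Q) (φ := fun ω (k : Fin l) => L k ω)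
      (measurable_pi_lambda _ fun k => hLm _).aemeasurable hf.aestronglyMeasurable
    rw [hmap, h2] at h1
    simp only [hA, pool, Finset.sum_range]
    exact h1.symm
  have hw : ∑ _i : Fin (l + 1), 1 / ((l : ℝ) + 1) = 1 := by
    simp only [Finset.sum_const, Finset.card_univ, Fintype.card_fin, nsmul_eq_mul]
    push_cast
    field_simp
  calc ∫ ω, ψ (pool L (l + 1) ω) ∂Q
      ≤ ∫ ω, ∑ i : Fin (l + 1), (1 / ((l : ℝ) + 1)) • ψ (A i ω) ∂Q := by
        refine integral_mono (integrable_monotone_comp hm (pool_mem_LOne hL _))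
          (integrable_finsetSum _ fun i _ => (integrable_monotone_comp hm (hAL i)).fun_smul _)
          fun ω => ?_
        dsimp only
        rw [pool, sum_div_eq_sum_succAbove hl fun k => L k ω]
        exact hc.map_sum_le (fun i _ => by positivity) hw fun i _ => mem_univ _
    _ = ∑ i : Fin (l + 1), (1 / ((l : ℝ) + 1)) • ∫ ω, ψ (A i ω) ∂Q := by
        rw [integral_finsetSum _ fun i _ => (integrable_monotone_comp hm (hAL i)).fun_smul _]
        simp_rw [integral_smul]
    _ = ∫ ω, ψ (pool L l ω) ∂Q := by
        simp_rw [hlaw]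
        rw [← Finset.sum_smul, hw, one_smul]

lemma CondIID.integral_pool_le (hL : ∀ i, L i ∈ LOne Ω) (h : CondIID Q L) {l l' : ℕ}
    (hl : 1 ≤ l) (hll : l ≤ l') {ψ : ℝ → ℝ} (hm : Monotone ψ) (hc : ConvexOn ℝ univ ψ) :
    ∫ ω, ψ (pool L l' ω) ∂Q ≤ ∫ ω, ψ (pool L l ω) ∂Q := by
  induction l', hll using Nat.le_induction with
  | base => exact le_rfl
  | succ n hn ih => exact (h.integral_pool_succ_le hL (hl.trans hn) hm hc).trans ih

end Pooling

lemma monotone_tranche {K : ℝ} (hK : K < 1) : Monotone fun x : ℝ => max (x - K) 0 / (1 - K) :=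
  fun x y hxy => div_le_div_of_nonneg_right (max_le_max_right _ (by linarith))
    (sub_nonneg.2 hK.le)

lemma convexOn_tranche {K : ℝ} (hK : K < 1) :
    ConvexOn ℝ univ fun x : ℝ => max (x - K) 0 / (1 - K) := by
  have h : ConvexOn ℝ univ fun x : ℝ => max (x - K) 0 :=
    ConvexOn.sup ((convexOn_id convex_univ).sub (concaveOn_const K convex_univ))
      (convexOn_const 0 convex_univ)
  have := h.smul (inv_nonneg.2 (sub_nonneg.2 hK.le))
  simpa [div_eq_inv_mul] using this

section

variable {Ω : Type*} [MeasurableSpace Ω]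

lemma seniorTranche_mem_LOne {X : Ω → ℝ} (hX : X ∈ LOne Ω) {K : ℝ} (hK : K ∈ Ico (0 : ℝ) 1) :
    seniorTranche X K ∈ LOne Ω := by
  refine ⟨((hX.1.sub_const K).max measurable_const).div_const _, fun ω => ⟨?_, ?_⟩⟩
  · exact div_nonneg (le_max_right _ _) (sub_nonneg.2 hK.2.le)
  · exact div_le_one_of_le₀ (max_le (by linarith [(hX.2 ω).2]) (sub_nonneg.2 hK.2.le))
      (sub_nonneg.2 hK.2.le)

/-- The tranche payoff is increasing and convex, so composing it with an increasing convex φ gives a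
function to which the pooling inequality applies. -/
theorem SRiskAverse.sPooling {P : Measure Ω} [IsProbabilityMeasure P] {s : ℕ}
    {S : Fin s → Set Ω} (hS : IsScenarios P S) {ρ : (Ω → ℝ) → ℝ} (h : SRiskAverse P S ρ) :
    SPooling P S ρ := by
  intro K hK L hL hc l l' hl hll
  refine h _ (LOne.mem_Linfty (seniorTranche_mem_LOne (pool_mem_LOne hL _) hK)) _
    (LOne.mem_Linfty (seniorTranche_mem_LOne (pool_mem_LOne hL _) hK)) fun φ hφ hφc j => ?_
  have := hS.isProbabilityMeasure_cond j
  refine (hc j).integral_pool_le hL hl hll (ψ := fun x => φ (max (x - K) 0 / (1 - K)))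
    (hφ.comp (monotone_tranche hK.2)) ⟨convex_univ, fun x _ y _ a b ha hb hab => ?_⟩
  exact (hφ ((convexOn_tranche hK.2).2 (mem_univ x) (mem_univ y) ha hb hab)).trans
    (hφc.2 (mem_univ _) (mem_univ _) ha hb hab)

lemma SPooling.sPoolingStar {P : Measure Ω} {s : ℕ} {S : Fin s → Set Ω} {ρ : (Ω → ℝ) → ℝ}
    (h : SPooling P S ρ) : SPoolingStar P S ρ := h 0 ⟨le_rfl, one_pos⟩

end

end ScenarioRisk

/-! ### Conditionally iid mixtures -/

namespace ScenarioRisk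

section Mixture

variable {Ω : Type*} [MeasurableSpace Ω] {Q : Measure Ω} [IsProbabilityMeasure Q]

/-- The law of a uniform variable together with an independent sequence of iid uniforms. -/
noncomputable abbrev uniformNoise : Measure (unitInterval × (ℕ → unitInterval)) :=
  (volume : Measure unitInterval).prod (Measure.infinitePi fun _ : ℕ => volume)

/-- Fubini: once the first coordinate u is fixed, the constraints concern independent coordinates
and their probabilities multiply. -/
lemma uniformNoise_inter {T : Set unitInterval} (hT : MeasurableSet T) (I : Finset ℕ)
    {C : ℕ → Set (unitInterval × unitInterval)} (hC : ∀ i, MeasurableSet (C i)) :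
    uniformNoise {z | z.1 ∈ T ∧ ∀ i ∈ I, (z.1, z.2 i) ∈ C i} =
      ∫⁻ u in T, ∏ i ∈ I, volume (Prod.mk u ⁻¹' C i) := by
  have hm : MeasurableSet {z : unitInterval × (ℕ → unitInterval) |
      z.1 ∈ T ∧ ∀ i ∈ I, (z.1, z.2 i) ∈ C i} := by
    refine (measurable_fst hT).inter ?_
    have : {z : unitInterval × (ℕ → unitInterval) | ∀ i ∈ I, (z.1, z.2 i) ∈ C i} =
        ⋂ i ∈ I, (fun z => (z.1, z.2 i)) ⁻¹' C i := by ext; simp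
    rw [show (fun a : unitInterval × (ℕ → unitInterval) => ∀ i ∈ I, (a.1, a.2 i) ∈ C i) =
      {z | ∀ i ∈ I, (z.1, z.2 i) ∈ C i} from rfl, this]
    exact Finset.measurableSet_biInter I fun i _ =>
      (measurable_fst.prodMk ((measurable_pi_apply i).comp measurable_snd)) (hC i)
  rw [Measure.prod_apply hm, ← lintegral_indicator hT]
  refine lintegral_congr fun u => ?_
  by_cases hu : u ∈ T
  · rw [indicator_of_mem hu, ← Measure.infinitePi_pi (fun _ : ℕ => (volume : Measure unitInterval))
      (s := I) (t := fun i => Prod.mk u ⁻¹' C i) fun i _ => measurable_prodMk_left (hC i)]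
    congr 1
    ext x
    simp [hu]
  · rw [indicator_of_notMem hu]
    have : Prod.mk u ⁻¹' {z : unitInterval × (ℕ → unitInterval) |
        z.1 ∈ T ∧ ∀ i ∈ I, (z.1, z.2 i) ∈ C i} = ∅ := by ext x; simp [hu]
    rw [this, measure_empty]

/-- Mixtures `F (U, ξᵢ)` with `ξ` an iid sequence independent of `U` are conditionally iid. -/
theorem condIID_of_map_eq {W : Ω → unitInterval × (ℕ → unitInterval)} (hW : Measurable W)
    (hlaw : Q.map W = uniformNoise) {F : unitInterval × unitInterval → ℝ} (hF : Measurable F)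
    {L : ℕ → Ω → ℝ} (hLm : ∀ i, Measurable (L i))
    (hL : ∀ i, ∀ᵐ ω ∂Q, L i ω = F ((W ω).1, (W ω).2 i)) : CondIID Q L := by
  have hU : Measurable fun ω => (W ω).1 := measurable_fst.comp hW
  have hZ : Measurable fun ω (_ : Fin 1) => ((W ω).1 : ℝ) :=
    measurable_pi_lambda _ fun _ => hU.subtype_val
  have hle := hZ.comap_le
  have hUm : Measurable[MeasurableSpace.comap (fun ω (_ : Fin 1) => ((W ω).1 : ℝ)) inferInstance]
      fun ω => (W ω).1 := by
    have h1 : Measurable fun z : Fin 1 → ℝ => projIcc (0 : ℝ) 1 zero_le_one (z 0) :=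
      continuous_projIcc.measurable.comp (measurable_pi_apply 0)
    have h2 := h1.comp (comap_measurable (fun ω (_ : Fin 1) => ((W ω).1 : ℝ)))
    convert h2 using 1
    ext ω
    simp
  have hmarg : Q.map (fun ω => (W ω).1) = volume := by
    rw [show (fun ω => (W ω).1) = Prod.fst ∘ W from rfl, ← Measure.map_map measurable_fst hW, hlaw]
    simp [Measure.map_fst_prod]
  -- Given U = u, the event {L i ∈ B i for i ∈ I} has probability the product of the volumes of the
  -- sections at u. Both the product formula and the equality of conditional laws follow, with the
  -- sets I = {i} for single factors.
  have key : ∀ (I : Finset ℕ) (B : ℕ → Set ℝ), (∀ i, MeasurableSet (B i)) →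
      (fun ω => (∏ i ∈ I, volume (Prod.mk (W ω).1 ⁻¹' (F ⁻¹' B i))).toReal) =ᵐ[Q]
      Q⟦⋂ i ∈ I, L i ⁻¹' B i | MeasurableSpace.comap (fun ω (_ : Fin 1) => ((W ω).1 : ℝ))
        inferInstance⟧ := by
    intro I B hB
    have hC : ∀ i, MeasurableSet (F ⁻¹' B i) := fun i => hF (hB i)
    have hAm : MeasurableSet (⋂ i ∈ I, L i ⁻¹' B i) :=
      Finset.measurableSet_biInter I fun i _ => hLm i (hB i)
    have hk : Measurable fun u => ∏ i ∈ I, volume (Prod.mk u ⁻¹' (F ⁻¹' B i)) :=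
      Finset.measurable_prod _ fun i _ => measurable_measure_prodMk_left (hC i)
    have hk1 : ∀ u, ∏ i ∈ I, volume (Prod.mk u ⁻¹' (F ⁻¹' B i)) ≤ 1 := fun u =>
      Finset.prod_le_one' fun i _ => prob_le_one
    have hint : Integrable (fun ω => (∏ i ∈ I, volume (Prod.mk (W ω).1 ⁻¹' (F ⁻¹' B i))).toReal)
        Q := by
      refine Integrable.of_bound (hk.ennreal_toReal.comp hU).aestronglyMeasurable 1
        (.of_forall fun ω => ?_)
      rw [Real.norm_eq_abs, abs_of_nonneg ENNReal.toReal_nonneg]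
      exact ENNReal.toReal_le_of_le_ofReal zero_le_one (by simpa using hk1 (W ω).1)
    refine ae_eq_condExp_of_forall_setIntegral_eq hle
      ((integrable_const (1 : ℝ)).indicator hAm) (fun _ _ _ => hint.integrableOn) ?_
      (hk.ennreal_toReal.comp hUm).aestronglyMeasurable
    rintro A ⟨T, hT, rfl⟩ -
    set T' : Set unitInterval := (fun u (_ : Fin 1) => (u : ℝ)) ⁻¹' T with hT'
    have hT'm : MeasurableSet T' := (measurable_pi_lambda _ fun _ => measurable_subtype_coe) hT
    have eA : (fun ω (_ : Fin 1) => ((W ω).1 : ℝ)) ⁻¹' T = (fun ω => (W ω).1) ⁻¹' T' := rfl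
    rw [eA, ← setIntegral_map (f := fun u => (∏ i ∈ I, volume (Prod.mk u ⁻¹' (F ⁻¹' B i))).toReal)
      hT'm hk.ennreal_toReal.aestronglyMeasurable hU.aemeasurable, hmarg,
      integral_toReal hk.aemeasurable (.of_forall fun u => (hk1 u).trans_lt ENNReal.one_lt_top),
      ← uniformNoise_inter hT'm I hC, ← hlaw]
    have hset : MeasurableSet {z : unitInterval × (ℕ → unitInterval) |
        z.1 ∈ T' ∧ ∀ i ∈ I, (z.1, z.2 i) ∈ F ⁻¹' B i} := by
      refine (measurable_fst hT'm).inter ?_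
      have : {z : unitInterval × (ℕ → unitInterval) | ∀ i ∈ I, (z.1, z.2 i) ∈ F ⁻¹' B i} =
          ⋂ i ∈ I, (fun z => (z.1, z.2 i)) ⁻¹' (F ⁻¹' B i) := by ext; simp
      rw [show (fun a : unitInterval × (ℕ → unitInterval) => ∀ i ∈ I, (a.1, a.2 i) ∈ F ⁻¹' B i) =
        {z | ∀ i ∈ I, (z.1, z.2 i) ∈ F ⁻¹' B i} from rfl, this]
      exact Finset.measurableSet_biInter I fun i _ =>
        (measurable_fst.prodMk ((measurable_pi_apply i).comp measurable_snd)) (hC i)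
    rw [Measure.map_apply hW hset, setIntegral_indicator hAm]
    simp only [integral_const, MeasurableSet.univ, measureReal_restrict_apply, univ_inter,
      smul_eq_mul, mul_one]
    rw [measureReal_def]
    congr 1
    refine measure_congr ?_
    filter_upwards [ae_all_iff.2 hL] with ω hω
    apply propext
    change ((W ω).1 ∈ T' ∧ ∀ i ∈ I, F ((W ω).1, (W ω).2 i) ∈ B i) ↔
      ω ∈ (fun ω => (W ω).1) ⁻¹' T' ∩ ⋂ i ∈ I, L i ⁻¹' B i
    simp [hω]
  refine ⟨1, _, hZ, ?_, ?_⟩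
  · intro I B hB
    have h1 : ∀ᵐ ω ∂Q, ∀ i, (volume (Prod.mk (W ω).1 ⁻¹' (F ⁻¹' B i))).toReal =
        (Q⟦L i ⁻¹' B i | MeasurableSpace.comap (fun ω (_ : Fin 1) => ((W ω).1 : ℝ))
          inferInstance⟧) ω := ae_all_iff.2 fun i => by
      have := key {i} B hB
      simp only [Finset.prod_singleton, Finset.mem_singleton, iInter_iInter_eq_left] at this
      exact this
    filter_upwards [key I B hB, h1] with ω h2 h3
    rw [← h2, ENNReal.toReal_prod, Finset.prod_apply]
    exact Finset.prod_congr rfl fun i _ => h3 i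
  · intro i k B hB
    have h1 := key {i} (fun _ => B) fun _ => hB
    have h2 := key {k} (fun _ => B) fun _ => hB
    simp only [Finset.prod_singleton, Finset.mem_singleton, iInter_iInter_eq_left] at h1 h2
    exact h1.symm.trans h2

lemma volume_real_lt_half : volume.real {u : unitInterval | (u : ℝ) < 1 / 2} = 1 / 2 := by
  rw [show {u : unitInterval | (u : ℝ) < 1 / 2} = Iio ⟨1 / 2, by norm_num, by norm_num⟩ from rfl,
    measureReal_def, unitInterval.volume_Iio, ENNReal.toReal_ofReal (by norm_num)]

/-- The law of large numbers for fair coins. -/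
lemma tendsto_average_coin :
    ∀ᵐ x ∂(Measure.infinitePi fun _ : ℕ => (volume : Measure unitInterval)),
      Tendsto (fun n : ℕ => (∑ i ∈ Finset.range n,
        {u : unitInterval | (u : ℝ) < 1 / 2}.indicator (1 : unitInterval → ℝ) (x i)) / n)
        atTop (𝓝 (1 / 2)) := by
  set H : Set unitInterval := {u | (u : ℝ) < 1 / 2} with hH
  have hHm : MeasurableSet H := measurableSet_lt measurable_subtype_coe measurable_const
  have hHv : volume.real H = 1 / 2 := volume_real_lt_half
  have hf : Measurable (H.indicator (1 : unitInterval → ℝ)) := measurable_one.indicator hHm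
  have hmp := fun i => measurePreserving_eval_infinitePi
    (fun _ : ℕ => (volume : Measure unitInterval)) i
  have hint : Integrable (fun x : ℕ → unitInterval => H.indicator (1 : unitInterval → ℝ) (x 0))
      (Measure.infinitePi fun _ : ℕ => (volume : Measure unitInterval)) :=
    (hmp 0).integrable_comp_of_integrable ((integrable_const (1 : ℝ)).indicator hHm)
  have h := strong_law_ae_real
    (μ := Measure.infinitePi fun _ : ℕ => (volume : Measure unitInterval))
    (fun i x => H.indicator (1 : unitInterval → ℝ) (x i)) hint
    (fun i k hik => (iIndepFun_infinitePi (X := fun _ => H.indicator (1 : unitInterval → ℝ))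
      fun _ => hf).indepFun hik)
    (fun i => by
      refine ⟨(hf.comp (measurable_pi_apply i)).aemeasurable,
        (hf.comp (measurable_pi_apply 0)).aemeasurable, ?_⟩
      have hi : ∀ i, (Measure.infinitePi fun _ : ℕ => (volume : Measure unitInterval)).map
          (fun x => H.indicator (1 : unitInterval → ℝ) (x i)) = volume.map (H.indicator 1) :=
        fun i => (Measure.map_map hf (measurable_pi_apply i)).symm.trans
          (congrArg (Measure.map (H.indicator 1)) (hmp i).map_eq)
      rw [hi, hi])
  have e : ∫ x, H.indicator (1 : unitInterval → ℝ) (x 0)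
      ∂(Measure.infinitePi fun _ : ℕ => (volume : Measure unitInterval)) = 1 / 2 := by
    have h0 := integral_map
      (μ := Measure.infinitePi fun _ : ℕ => (volume : Measure unitInterval))
      (hmp 0).measurable.aemeasurable
      (f := H.indicator (1 : unitInterval → ℝ)) hf.aestronglyMeasurable
    rw [(hmp 0).map_eq, integral_indicator_one hHm, hHv] at h0
    exact h0.symm
  rwa [e] at h

end Mixture

end ScenarioRisk

/-! ### From the pooling effect back to decreasing increments -/

namespace ScenarioRisk

variable {Ω : Type*} [MeasurableSpace Ω] {P : Measure Ω} [IsProbabilityMeasure P] {s : ℕ}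
  {S : Fin s → Set Ω} {g : (Fin s → ℝ) → ℝ} {ρ : (Ω → ℝ) → ℝ}

lemma seniorTranche_zero {X : Ω → ℝ} (hX : X ∈ LOne Ω) : seniorTranche X 0 = X := by
  ext ω
  simp [seniorTranche, (hX.2 ω).1]

omit [MeasurableSpace Ω] in
lemma pool_one (L : ℕ → Ω → ℝ) : pool L 1 = L 0 := by
  ext ω
  simp [pool]

/-- The interval `[a, b)` in the unit interval. -/
def unitIco (a b : ℝ) : Set unitInterval := {u | a ≤ u ∧ (u : ℝ) < b}

lemma measurableSet_unitIco (a b : ℝ) : MeasurableSet (unitIco a b) :=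
  (measurableSet_le measurable_const measurable_subtype_coe).inter
    (measurableSet_lt measurable_subtype_coe measurable_const)

lemma volume_real_unitIco {a b : ℝ} (ha : 0 ≤ a) (hab : a ≤ b) (hb : b ≤ 1) :
    volume.real (unitIco a b) = b - a := by
  rw [show unitIco a b = Ico ⟨a, ha, hab.trans hb⟩ ⟨b, ha.trans hab, hb⟩ from rfl, measureReal_def,
    unitInterval.volume_Ico, ENNReal.toReal_ofReal (sub_nonneg.2 hab)]

/-- The event that a fair coin, encoded by a uniform variable, shows heads. -/
def heads : Set unitInterval := {u | (u : ℝ) < 1 / 2}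

lemma measurableSet_heads : MeasurableSet heads :=
  measurableSet_lt measurable_subtype_coe measurable_const

/-- Loss of one contract: `1` for `u ∈ [0,a)`, a fair coin for `u ∈ [a,b)`, `1/2` for
`u ∈ [b,c)`, and `0` otherwise. -/
noncomputable def coinLoss (a b c : ℝ) (z : unitInterval × unitInterval) : ℝ :=
  (unitIco 0 a).indicator 1 z.1 + (unitIco a b).indicator 1 z.1 * heads.indicator 1 z.2
    + 1 / 2 * (unitIco b c).indicator 1 z.1

lemma measurable_coinLoss (a b c : ℝ) : Measurable (coinLoss a b c) := by
  have h : ∀ {T : Set unitInterval}, MeasurableSet T →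
      Measurable (T.indicator (1 : unitInterval → ℝ)) := fun hT => measurable_one.indicator hT
  exact (((h (measurableSet_unitIco 0 a)).comp measurable_fst).add
    (((h (measurableSet_unitIco a b)).comp measurable_fst).mul
      ((h measurableSet_heads).comp measurable_snd))).add
    (((h (measurableSet_unitIco b c)).comp measurable_fst).const_mul _)

lemma coinLoss_mem_Icc (a b c : ℝ) (hab : a ≤ b)
    (z : unitInterval × unitInterval) : coinLoss a b c z ∈ Icc (0 : ℝ) 1 := by
  by_cases h1 : z.1 ∈ unitIco 0 a <;> by_cases h2 : z.1 ∈ unitIco a b <;>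
    by_cases h3 : z.1 ∈ unitIco b c <;> by_cases h4 : z.2 ∈ heads <;>
    simp only [coinLoss, h1, h2, h3, h4, indicator_of_mem, indicator_of_notMem, not_false_eq_true,
      Pi.one_apply] <;>
    first
    | (constructor <;> norm_num; done)
    | exact absurd h1.2 (not_lt.2 h2.1)
    | exact absurd h1.2 (not_lt.2 (hab.trans h3.1))
    | exact absurd h2.2 (not_lt.2 h3.1)

/-- The pooling effect transfers mass between two levels of a loss. -/
theorem IsDistortionRiskMeasure.add_le_add_of_sPoolingStar (hP : Atomless P)
    (hS : IsScenarios P S) (hρ : IsDistortionRiskMeasure P S g ρ) (hl : LebesgueContinuous P ρ)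
    (hp : SPoolingStar P S ρ) {v w h : Fin s → ℝ} (hv : 0 ≤ v) (hh : 0 ≤ h) (hvw : v + h ≤ w)
    (hw : w + h ≤ 1) : g (w + h) + g v ≤ g (v + h) + g w := by
  obtain ⟨J, hJ, hJS⟩ := hS.exists_index
  obtain ⟨W, hW, hlaw⟩ := hS.exists_map_eq hP fun _ => uniformNoise
  have hU : Measurable fun ω => (W ω).1 := measurable_fst.comp hW
  have hξ : ∀ i, Measurable fun ω => (W ω).2 i := fun i =>
    (measurable_pi_apply i).comp (measurable_snd.comp hW)
  have hQ := hS.isProbabilityMeasure_cond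
  set R : (Fin s → ℝ) → (Fin s → ℝ) → Set Ω := fun a b => {ω | (W ω).1 ∈ unitIco (a (J ω)) (b (J ω))}
    with hR
  set H : Set Ω := {ω | (W ω).2 0 ∈ heads} with hH
  have hRm : ∀ a b, MeasurableSet (R a b) := fun a b =>
    (measurableSet_le ((measurable_from_top (f := a)).comp hJ) hU.subtype_val).inter
      (measurableSet_lt hU.subtype_val ((measurable_from_top (f := b)).comp hJ))
  have hHm : MeasurableSet H := hξ 0 measurableSet_heads
  have hcongr : ∀ j (a b : Fin s → ℝ), R a b =ᵐ[P[|S j]] (fun ω => (W ω).1) ⁻¹' unitIco (a j) (b j) := by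
    intro j a b
    filter_upwards [ae_cond_mem (hS.measurableSet j)] with ω hω
    have : J ω = j := (hJS ω j).1 hω
    change ((W ω).1 ∈ unitIco (a (J ω)) (b (J ω))) = ((W ω).1 ∈ unitIco (a j) (b j))
    rw [this]
  have hprob : ∀ a b : Fin s → ℝ, 0 ≤ a → a ≤ b → b ≤ 1 → scenarioProb P S (R a b) = b - a := by
    intro a b ha hab hb
    ext j
    rw [scenarioProb, measureReal_def, measure_congr (hcongr j a b),
      show (fun ω => (W ω).1) ⁻¹' unitIco (a j) (b j) = W ⁻¹' (unitIco (a j) (b j) ×ˢ univ) by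
        ext; simp, ← Measure.map_apply hW ((measurableSet_unitIco _ _).prod .univ), hlaw,
      Measure.prod_prod, measure_univ, mul_one]
    exact volume_real_unitIco (ha j) (hab j) (hb j)
  have hprobH : ∀ a b : Fin s → ℝ, 0 ≤ a → a ≤ b → b ≤ 1 →
      scenarioProb P S (R a b ∩ H) = fun j => (b j - a j) * (1 / 2) := by
    intro a b ha hab hb
    ext j
    rw [scenarioProb, measureReal_def, measure_congr ((hcongr j a b).inter (ae_eq_refl H)),
      show (fun ω => (W ω).1) ⁻¹' unitIco (a j) (b j) ∩ H =
        W ⁻¹' (unitIco (a j) (b j) ×ˢ (Function.eval 0 ⁻¹' heads)) by ext; simp [hH],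
      ← Measure.map_apply hW ((measurableSet_unitIco _ _).prod
        (measurable_pi_apply 0 measurableSet_heads)), hlaw, Measure.prod_prod,
      (measurePreserving_eval_infinitePi (fun _ : ℕ => (volume : Measure unitInterval))
        0).measure_preimage measurableSet_heads.nullMeasurableSet, ENNReal.toReal_mul]
    exact congrArg₂ _ (volume_real_unitIco (ha j) (hab j) (hb j)) volume_real_lt_half
  -- The coin region M has mass 2h, so that heads contributes exactly h. The region N, where the
  -- loss is 1/2, fills up to w + h; it can have mass w - v - h because v + h ≤ w.
  set A := R 0 v with hA
  set M := R v (v + (h + h)) with hM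
  set N := R (v + (h + h)) (w + h) with hN
  have hh2 : v ≤ v + (h + h) := le_add_of_nonneg_right (add_nonneg hh hh)
  have hle : v + (h + h) ≤ w + h := by rw [← add_assoc]; exact add_le_add_left hvw h
  have hAM : Disjoint A M := disjoint_left.2 fun ω h1 h2 => absurd h1.2 (not_lt.2 h2.1)
  have hAN : Disjoint A N := disjoint_left.2 fun ω h1 h2 =>
    absurd h1.2 (not_lt.2 ((hh2 (J ω)).trans h2.1))
  have hMN : Disjoint M N := disjoint_left.2 fun ω h1 h2 => absurd h1.2 (not_lt.2 h2.1)
  have pA : scenarioProb P S A = v := by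
    rw [hprob 0 v le_rfl hv (hh2.trans (hle.trans hw)), sub_zero]
  have pN : scenarioProb P S N = w - v - h := by
    rw [hprob _ _ (hv.trans hh2) hle hw]; abel
  have pM : scenarioProb P S M = h + h := by
    rw [hprob _ _ hv hh2 (hle.trans hw)]; abel
  have pMH : scenarioProb P S (M ∩ H) = h := by
    rw [hprobH _ _ hv hh2 (hle.trans hw)]
    ext j
    simp only [Pi.add_apply]
    ring
  set L : ℕ → Ω → ℝ := fun i ω =>
    coinLoss (v (J ω)) (v (J ω) + (h (J ω) + h (J ω))) (w (J ω) + h (J ω)) ((W ω).1, (W ω).2 i)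
    with hL
  have hLm : ∀ i, Measurable (L i) := fun i =>
    (measurable_from_prod_countable_right
      (f := fun x : Fin s × (unitInterval × unitInterval) =>
        coinLoss (v x.1) (v x.1 + (h x.1 + h x.1)) (w x.1 + h x.1) x.2)
      fun j => measurable_coinLoss (v j) (v j + (h j + h j)) (w j + h j)).comp (hJ.prodMk (hU.prodMk (hξ i)))
  have hL1 : ∀ i, L i ∈ LOne Ω := fun i => ⟨hLm i, fun ω => coinLoss_mem_Icc _ _ _ (hh2 _) _⟩
  -- Under P_j the thresholds are almost surely the constants of scenario j, so L is a mixture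
  -- there; the mixing function may differ between scenarios.
  have hLc : ∀ j, CondIID (P[|S j]) L := fun j =>
    condIID_of_map_eq hW (hlaw j) (measurable_coinLoss (v j) (v j + (h j + h j)) (w j + h j)) hLm
      fun i => by
        filter_upwards [ae_cond_mem (hS.measurableSet j)] with ω hω
        simp only [hL, (hJS ω j).1 hω]
  have hLeq : ∀ i ω, L i ω = A.indicator 1 ω + M.indicator 1 ω * heads.indicator 1 ((W ω).2 i)
      + 1 / 2 * N.indicator 1 ω := fun i ω => rfl
  -- The limit of the pooled losses: by the law of large numbers each coin is replaced by its mean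
  -- 1/2.
  set Y : Ω → ℝ := fun ω => 1 / 2 * (A.indicator 1 ω + (A ∪ M ∪ N).indicator 1 ω) with hY
  have hYeq : ∀ ω, Y ω = A.indicator 1 ω + M.indicator 1 ω * (1 / 2)
      + 1 / 2 * N.indicator 1 ω := fun ω => by
    simp only [hY]
    rw [indicator_union_of_disjoint (disjoint_union_left.2 ⟨hAN, hMN⟩),
      indicator_union_of_disjoint hAM]
    ring
  have hYL : (fun ω => A.indicator 1 ω + (A ∪ M ∪ N).indicator 1 ω) ∈ Linfty Ω :=
    Linfty.add (Linfty.indicator (hRm _ _)) (Linfty.indicator (((hRm _ _).union (hRm _ _)).union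
      (hRm _ _)))
  have hcoin : ∀ᵐ ω ∂P, Tendsto (fun n : ℕ => (∑ i ∈ Finset.range n,
      heads.indicator (1 : unitInterval → ℝ) ((W ω).2 i)) / n) atTop (𝓝 (1 / 2)) := by
    rw [ae_iff_forall_ae_cond hS]
    intro j
    have h1 : (P[|S j]).map (fun ω => (W ω).2) =
        Measure.infinitePi fun _ : ℕ => (volume : Measure unitInterval) := by
      rw [show (fun ω => (W ω).2) = Prod.snd ∘ W from rfl, ← Measure.map_map measurable_snd hW,
        hlaw]
      simp [Measure.map_snd_prod]
    have h2 := tendsto_average_coin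
    rw [← h1] at h2
    exact ae_of_ae_map (measurable_snd.comp hW).aemeasurable h2
  have hlim := hl (pool L) Y (fun l => (pool_mem_LOne hL1 l).1)
    ⟨1, fun l ω => abs_le.2 ⟨by linarith [((pool_mem_LOne hL1 l).2 ω).1],
      ((pool_mem_LOne hL1 l).2 ω).2⟩⟩ (Linfty.const_mul hYL (1 / 2)) (by
    filter_upwards [hcoin] with ω hω
    rw [hYeq]
    refine (((hω.const_mul (M.indicator 1 ω)).const_add (A.indicator 1 ω)).add_const
      (1 / 2 * N.indicator 1 ω)).congr' ?_
    filter_upwards [eventually_gt_atTop 0] with n hn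
    have hn' : (n : ℝ) ≠ 0 := by exact_mod_cast hn.ne'
    simp only [pool, hLeq, Finset.sum_add_distrib, Finset.sum_const, Finset.card_range,
      nsmul_eq_mul, ← Finset.mul_sum]
    field_simp)
  have hbound : ρ Y ≤ ρ (L 0) := by
    refine le_of_tendsto hlim ?_
    filter_upwards [eventually_ge_atTop 1] with n hn
    have := hp L hL1 hLc 1 n le_rfl hn
    rwa [seniorTranche_zero (pool_mem_LOne hL1 _), seniorTranche_zero (pool_mem_LOne hL1 _),
      pool_one] at this
  have hAH : Disjoint A (M ∩ H) := hAM.mono_right inter_subset_left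
  have hMHN : Disjoint (M ∩ H) N := hMN.mono_left inter_subset_left
  have hL0 : L 0 = fun ω => 1 / 2 *
      ((A ∪ M ∩ H).indicator 1 ω + (A ∪ M ∩ H ∪ N).indicator 1 ω) := by
    ext ω
    rw [hLeq, indicator_union_of_disjoint (disjoint_union_left.2 ⟨hAN, hMHN⟩),
      indicator_union_of_disjoint hAH, inter_indicator_one]
    simp only [Pi.mul_apply]
    rw [show H.indicator (1 : Ω → ℝ) ω = heads.indicator 1 ((W ω).2 0) from rfl]
    ring
  have hAMH := (hRm 0 v).union ((hRm v (v + (h + h))).inter hHm)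
  have hAMHN := hAMH.union (hRm (v + (h + h)) (w + h))
  have hAMN := ((hRm 0 v).union (hRm v (v + (h + h)))).union (hRm (v + (h + h)) (w + h))
  -- Both losses are half a sum of two nested indicators. The limit gives (g (w + h) + g v) / 2 and
  -- the single loss (g w + g (v + h)) / 2.
  rw [hL0, hY, hρ.const_mul hS hYL (by norm_num), hρ.const_mul hS
    (Linfty.add (Linfty.indicator hAMH) (Linfty.indicator hAMHN)) (by norm_num),
    hρ.apply_indicator_add hS (hRm _ _) hAMN, hρ.apply_indicator_add hS hAMH hAMHN,
    union_eq_right.2 (subset_union_left.trans subset_union_left),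
    inter_eq_left.2 (subset_union_left.trans subset_union_left),
    union_eq_right.2 subset_union_left, inter_eq_left.2 subset_union_left,
    hS.scenarioProb_union (disjoint_union_left.2 ⟨hAN, hMN⟩) (hRm _ _),
    hS.scenarioProb_union (disjoint_union_left.2 ⟨hAN, hMHN⟩) (hRm _ _),
    hS.scenarioProb_union hAM (hRm _ _), hS.scenarioProb_union hAH ((hRm _ _).inter hHm),
    pA, pM, pN, pMH, show v + (h + h) + (w - v - h) = w + h by abel,
    show v + h + (w - v - h) = w by abel] at hbound
  linarith

/-- The transfer inequality needs v + h ≤ w. Cutting h into n + 1 pieces and starting the upper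
chain one piece late ensures this at every step; continuity of g makes the missing piece negligible.
-/
theorem IsDistortionRiskMeasure.decreasingIncrements_of_sPoolingStar (hP : Atomless P)
    (hS : IsScenarios P S) (hρ : IsDistortionRiskMeasure P S g ρ) (hl : LebesgueContinuous P ρ)
    (hp : SPoolingStar P S ρ) : DecreasingIncrements g := by
  intro u h k hu hh hk h1
  have hkey : ∀ n : ℕ, g (u + h + k) - g (u + k + (1 / ((n : ℝ) + 1)) • h) ≤ g (u + h) - g u := by
    intro n
    set t : ℝ := 1 / ((n : ℝ) + 1) with ht
    have ht0 : 0 ≤ t := by positivity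
    have htn : (n + 1 : ℝ) * t = 1 := by rw [ht]; field_simp
    have hlast : ∀ m : ℕ, m ≤ n + 1 → ((m : ℝ) * t) • h ≤ h := fun m hm => by
      have hm' : (m : ℝ) ≤ n + 1 := by exact_mod_cast hm
      have : (m : ℝ) * t ≤ 1 := htn ▸ mul_le_mul_of_nonneg_right hm' ht0
      exact fun j => mul_le_of_le_one_left (hh j) this
    have hnn : ∀ m : ℕ, 0 ≤ ((m : ℝ) * t) • h := fun m => smul_nonneg (by positivity) hh
    set a : ℕ → ℝ := fun m => g (u + ((m : ℝ) * t) • h) with ha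
    set b : ℕ → ℝ := fun m => g (u + k + ((m : ℝ) * t) • h) with hb
    -- The upper index runs one ahead of the lower one, which supplies the separation v + t • h ≤ w.
    -- Summation leaves the first piece of the upper chain and the last piece of the lower chain
    -- uncovered; monotonicity of g disposes of the latter.
    have hstep : ∀ m ∈ Finset.range n, b (m + 1 + 1) - b (m + 1) ≤ a (m + 1) - a m := by
      intro m hm
      rw [Finset.mem_range] at hm
      have e1 : ∀ (c : Fin s → ℝ) (m : ℕ), c + ((m : ℝ) * t) • h + t • h =
          c + (((m + 1 : ℕ) : ℝ) * t) • h := fun c m => by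
        rw [add_assoc, ← add_smul]; push_cast; ring_nf
      have := hρ.add_le_add_of_sPoolingStar hP hS hl hp (v := u + ((m : ℝ) * t) • h)
        (w := u + k + (((m + 1 : ℕ) : ℝ) * t) • h) (h := t • h) (add_nonneg hu (hnn m))
        (smul_nonneg ht0 hh) (by
          rw [e1]
          exact add_le_add_left (le_add_of_nonneg_right hk) _) (by
          rw [e1]
          refine le_trans ?_ h1
          rw [add_right_comm u h k]
          exact add_le_add_right (hlast _ (by omega)) _)
      rw [e1, e1] at this
      simp only [ha, hb]
      linarith
    have hsum := Finset.sum_le_sum hstep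
    rw [Finset.sum_range_sub (fun m => b (m + 1)), Finset.sum_range_sub a] at hsum
    have han : a n ≤ g (u + h) := hρ.distortion.mono
      ⟨add_nonneg hu (hnn n), (add_le_add_right (hlast n (Nat.le_succ n)) u).trans
        ((le_add_of_nonneg_right hk).trans h1)⟩
      ⟨add_nonneg hu hh, (le_add_of_nonneg_right hk).trans h1⟩
      (add_le_add_right (hlast n (Nat.le_succ n)) u)
    have ha0 : a 0 = g u := by simp [ha]
    have hbn : b (n + 1) = g (u + h + k) := by
      simp only [hb]
      push_cast
      rw [htn, one_smul, add_right_comm]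
    have hb1 : b (0 + 1) = g (u + k + t • h) := by simp [hb]
    linarith
  have hcont := hρ.continuousOn hP hS hl (u + k) ⟨add_nonneg hu hk, by
    refine le_trans ?_ h1
    rw [add_right_comm]
    exact le_add_of_nonneg_right hh⟩
  have ht : Tendsto (fun n : ℕ => u + k + (1 / ((n : ℝ) + 1)) • h) atTop
      (𝓝[Icc 0 1] (u + k)) := by
    refine tendsto_nhdsWithin_iff.2 ⟨?_, .of_forall fun n => ⟨add_nonneg (add_nonneg hu hk)
      (smul_nonneg (by positivity) hh), ?_⟩⟩
    · simpa using (tendsto_one_div_add_atTop_nhds_zero_nat (𝕜 := ℝ)).smul_const h |>.const_add (u + k)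
    · refine le_trans ?_ h1
      rw [add_right_comm u h k]
      refine add_le_add_right (fun j => mul_le_of_le_one_left (hh j) ?_) _
      rw [div_le_one (by positivity)]
      linarith [(Nat.cast_nonneg n : (0 : ℝ) ≤ n)]
  have := le_of_tendsto' ((hcont.tendsto.comp ht).const_sub (g (u + h + k))) hkey
  linarith

end ScenarioRisk

/-! ### The equivalences -/

theorem theorem6 {Ω : Type*} [MeasurableSpace Ω] (P : Measure Ω) [IsProbabilityMeasure P]
    (hP : ScenarioRisk.Atomless P) {s : ℕ} (S : Fin s → Set Ω)
    (hS : ScenarioRisk.IsScenarios P S) (g : (Fin s → ℝ) → ℝ) (ρ : (Ω → ℝ) → ℝ)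
    (hρ : ScenarioRisk.IsDistortionRiskMeasure P S g ρ) :
    -- (i), (ii), (iii) are equivalent
    List.TFAE [
      ScenarioRisk.IsCoherent P ρ,
      ScenarioRisk.QuasiConvex ρ,
      ScenarioRisk.ComponentwiseConcave g ∧ ScenarioRisk.Submodular g] ∧
    -- they imply (iv), (v), (vi)
    (ScenarioRisk.IsCoherent P ρ →
      ScenarioRisk.SRiskAverse P S ρ ∧ ScenarioRisk.SPooling P S ρ ∧
        ScenarioRisk.SPoolingStar P S ρ) ∧
    -- Lebesgue continuity of `ρ` amounts to continuity of `g` on the cube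
    (ScenarioRisk.LebesgueContinuous P ρ ↔ ContinuousOn g (Icc (0 : Fin s → ℝ) 1)) ∧
    -- under Lebesgue continuity all six conditions are equivalent
    (ScenarioRisk.LebesgueContinuous P ρ →
      List.TFAE [
        ScenarioRisk.IsCoherent P ρ,
        ScenarioRisk.QuasiConvex ρ,
        ScenarioRisk.ComponentwiseConcave g ∧ ScenarioRisk.Submodular g,
        ScenarioRisk.SRiskAverse P S ρ,
        ScenarioRisk.SPooling P S ρ,
        ScenarioRisk.SPoolingStar P S ρ]) := by
  have h12 : ScenarioRisk.IsCoherent P ρ → ScenarioRisk.QuasiConvex ρ := fun h => h.quasiConvex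
  have h23 : ScenarioRisk.QuasiConvex ρ →
      ScenarioRisk.ComponentwiseConcave g ∧ ScenarioRisk.Submodular g := fun h =>
    (ScenarioRisk.decreasingIncrements_iff hρ.distortion.mono).1 (hρ.decreasingIncrements hP hS h)
  have h31 : ScenarioRisk.ComponentwiseConcave g ∧ ScenarioRisk.Submodular g →
      ScenarioRisk.IsCoherent P ρ := fun h =>
    hρ.isCoherent hS ((ScenarioRisk.decreasingIncrements_iff hρ.distortion.mono).2 h)
  have h14 : ScenarioRisk.IsCoherent P ρ → ScenarioRisk.SRiskAverse P S ρ := fun h =>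
    hρ.sRiskAverse hS (hρ.decreasingIncrements hP hS h.quasiConvex)
  have h45 : ScenarioRisk.SRiskAverse P S ρ → ScenarioRisk.SPooling P S ρ := fun h => h.sPooling hS
  have h56 : ScenarioRisk.SPooling P S ρ → ScenarioRisk.SPoolingStar P S ρ := fun h => h.sPoolingStar
  refine ⟨?_, fun h => ⟨h14 h, h45 (h14 h), h56 (h45 (h14 h))⟩,
    ⟨fun h => hρ.continuousOn hP hS h, fun h => hρ.lebesgueContinuous hS h⟩, fun hl => ?_⟩
  · tfae_have 1 → 2 := h12
    tfae_have 2 → 3 := h23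
    tfae_have 3 → 1 := h31
    tfae_finish
  · tfae_have 1 → 2 := h12
    tfae_have 2 → 3 := h23
    tfae_have 3 → 1 := h31
    tfae_have 1 → 4 := h14
    tfae_have 4 → 5 := h45
    tfae_have 5 → 6 := h56
    tfae_have 6 → 3 := fun h => (ScenarioRisk.decreasingIncrements_iff hρ.distortion.mono).1
      (hρ.decreasingIncrements_of_sPoolingStar hP hS hl h)
    tfae_finish
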